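/- Let $I \subset \mathbb{R}$ be compact (for instance $I=[0,1]$), let $\lambda$ be a Borel probability measure on $I$, and let $d,q$ be natural numbers. Let $$\mathcal{M}_\lambda := \{\mu \in \mathcal{P}_2(I\times\mathbb{R}^d) : \mathrm{pr}_1\sharp\mu = \lambda\}$$ be the set of Borel probability measures on $I\times\mathbb{R}^d$ with finite second moment and first marginal $\lambda$, with the topology of the 2-Wasserstein distance and its Borel $\sigma$-algebra. Let $\sigma:\mathbb{R}\to\mathbb{R}$ be a continuous activation function that is not a polynomial and for which there is a constant $L$ with $|\sigma(s)-\sigma(t)|\le L(1+|s-t|)$ for all $s,t$ (for example any non-affine Lipschitz function or any bounded continuous non-constant function, such as $\tanh$, the logistic function, or ReLU). A *net* from $\mathbb{R}^m$ to $\mathbb{R}^n$ is a function computed by a fully connected feedforward neural network with activation $\sigma$ (applied coordinatewise in the hidden layers), an affine output layer, and any finite number of hidden layers of any finite widths. Let $\rho$ be a probability measure on $\mathcal{M}_\lambda$ and $V : I\times\mathbb{R}^d\times\mathcal{M}_\lambda\to\mathbb{R}^q$ a continuous map with $$\int_{\mathcal{M}_\lambda}\int_{I\times\mathbb{R}^d}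 |V(u,x,\mu)|^2\,\mu(du,dx)\,\rho(d\mu) < \infty .$$ Then for every $\varepsilon>0$ there exist integers $J,r\ge 1$, continuous functions $\varphi_1,\dots,\varphi_J : I\times\mathbb{R}^d\to\mathbb{R}$, integrable with respect to every $\mu\in\mathcal{M}_\lambda$, nets $\mathcal{T}_1,\dots,\mathcal{T}_r$ from $\mathbb{R}\times\mathbb{R}^d$ to $\mathbb{R}$ (trunk nets, evaluated on $I\times\mathbb{R}^d$) and nets $\mathcal{B}_1,\dots,\mathcal{B}_r$ from $\mathbb{R}^J$ to $\mathbb{R}^q$ (branch nets) such that $$\int_{\mathcal{M}_\lambda}\int_{I\times\mathbb{R}^d} \Big|V(u,x,\mu)-\sum_{k=1}^r \mathcal{T}_k(u,x)\,\mathcal{B}_k(\Phi_J(\mu))\Big|^2\mu(du,dx)\,\rho(d\mu)\le\varepsilon,$$ where $\Phi_J(\mu) := \big(\int\varphi_1\,d\mu,\dots,\int\varphi_J\,d\mu\big)$. -/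

import Mathlib

open MeasureTheory
open scoped ENNReal

/-- The constrained Wasserstein space of square integrable Borel probability measures on `I × ℝ^d`
whose first marginal is `lam`. -/
structure LabelledMeasure {I : Set ℝ} (lam : Measure I) (d : ℕ) where
  toMeasure : Measure (I × EuclideanSpace ℝ (Fin d))
  isProbabilityMeasure : IsProbabilityMeasure toMeasure
  lintegral_sq_lt_top : ∫⁻ z, (‖(z.1 : ℝ)‖ₑ ^ 2 + ‖z.2‖ₑ ^ 2) ∂toMeasure < ∞
  map_fst : toMeasure.map Prod.fst = lam

namespace LabelledMeasure

variable {I : Set ℝ} {lam : Measure I} {d : ℕ}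

/-- The couplings of `μ` and `ν`. -/
def couplings (μ ν : LabelledMeasure lam d) :
    Set (Measure ((I × EuclideanSpace ℝ (Fin d)) × (I × EuclideanSpace ℝ (Fin d)))) :=
  {π | π.map Prod.fst = μ.toMeasure ∧ π.map Prod.snd = ν.toMeasure}

/-- The 2-Wasserstein distance, for the Euclidean distance
`|(u, x) - (v, y)|² = |u - v|² + |x - y|²` on `I × ℝ^d ⊆ ℝ^(1 + d)`. -/
noncomputable def W2 (μ ν : LabelledMeasure lam d) : ℝ≥0∞ :=
  (⨅ π ∈ couplings μ ν,
    ∫⁻ p, (edist p.1.1 p.2.1 ^ 2 + edist p.1.2 p.2.2 ^ 2) ∂π) ^ (1 / 2 : ℝ)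

/-- The topology of the distance `W2`: a set is open if and only if it contains a `W2`-ball around
each of its points. -/
instance : TopologicalSpace (LabelledMeasure lam d) where
  IsOpen U := ∀ μ ∈ U, ∃ r : ℝ≥0∞, 0 < r ∧ ∀ ν, W2 μ ν < r → ν ∈ U
  isOpen_univ := fun _ _ => ⟨1, one_pos, fun _ _ => Set.mem_univ _⟩
  isOpen_inter := by
    intro U U' hU hU' μ hμ
    obtain ⟨r, hr, h⟩ := hU μ hμ.1
    obtain ⟨r', hr', h'⟩ := hU' μ hμ.2
    exact ⟨min r r', lt_min hr hr', fun ν hν =>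
      ⟨h ν (hν.trans_le (min_le_left _ _)), h' ν (hν.trans_le (min_le_right _ _))⟩⟩
  isOpen_sUnion := by
    intro S hS μ hμ
    obtain ⟨U, hU, hμU⟩ := hμ
    obtain ⟨r, hr, h⟩ := hS U hU μ hμU
    exact ⟨r, hr, fun ν hν => ⟨U, hU, h ν hν⟩⟩

/-- The Borel σ-algebra of the `W2`-topology. -/
instance : MeasurableSpace (LabelledMeasure lam d) := borel _

instance : BorelSpace (LabelledMeasure lam d) := ⟨rfl⟩

end LabelledMeasure

/-- The parameters of a fully connected feedforward network with `m` inputs and `n` outputs, with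
any number of hidden layers of any widths: a chain of weight matrices and bias vectors. -/
inductive FeedforwardNet : ℕ → ℕ → Type
  | output {m n : ℕ} (W : Matrix (Fin n) (Fin m) ℝ) (b : Fin n → ℝ) : FeedforwardNet m n
  | hidden {m k n : ℕ} (W : Matrix (Fin k) (Fin m) ℝ) (b : Fin k → ℝ)
      (next : FeedforwardNet k n) : FeedforwardNet m n

/-- The function computed by a network with activation function `σ`: the hidden layers are
`y ↦ σ (W y + b)`, with `σ` applied to each coordinate, and the output layer is `y ↦ W y + b`. -/
def FeedforwardNet.eval (σ : ℝ → ℝ) :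
    {m n : ℕ} → FeedforwardNet m n → (Fin m → ℝ) → Fin n → ℝ
  | _, _, .output W b, y => W.mulVec y + b
  | _, _, .hidden W b next, y => next.eval σ (fun i => σ ((W.mulVec y + b) i))

/-- The vector `Φ_J(μ) = (⟨φ_1, μ⟩, …, ⟨φ_J, μ⟩)`. -/
noncomputable def cylindricalFeatures {I : Set ℝ} {lam : Measure I} {d J : ℕ}
    (φ : Fin J → C(I × EuclideanSpace ℝ (Fin d), ℝ)) (μ : LabelledMeasure lam d) : Fin J → ℝ :=
  fun j => ∫ z, φ j z ∂μ.toMeasure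

/-- The architecture `(u, x, μ) ↦ ∑ k, T_k(u, x) B_k(Φ_J(μ))`, with trunk nets `T k` from `ℝ^(1+d)`
to `ℝ` and branch nets `B k` from `ℝ^J` to `ℝ^q`. -/
noncomputable def deepONetCyl {I : Set ℝ} {lam : Measure I} {d q J r : ℕ} (σ : ℝ → ℝ)
    (φ : Fin J → C(I × EuclideanSpace ℝ (Fin d), ℝ))
    (T : Fin r → FeedforwardNet (d + 1) 1) (B : Fin r → FeedforwardNet J q)
    (p : I × EuclideanSpace ℝ (Fin d) × LabelledMeasure lam d) : EuclideanSpace ℝ (Fin q) :=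
  ∑ k, (T k).eval σ (Fin.cons (p.1 : ℝ) (fun i => p.2.1 i)) 0 •
    WithLp.toLp 2 ((B k).eval σ (cylindricalFeatures φ p.2.2))

/-! Put the measure `P(dμ, dz) = ρ(dμ) μ(dz)` on pairs `(μ, z)`. The error to be made small is then
a squared distance in `L²(P)`, so the theorem is a density statement. It needs no compactness on the
side of measures: an algebra of bounded measurable functions that generates the σ-algebra is dense
in `L²` of a probability measure (`exists_mem_span_eLpNorm_sub_le`). Three points remain.

Networks yield an algebra. For continuous non-affine `σ`, the function `t ↦ t²` is a locally uniform
limit of combinations of `σ (w t + b)` (`sq_mem_compactClosure`). By polarization, the bounded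
uniform limits of networks of arbitrary depth are closed under products (`netAlgebra`). The tensor
algebra of such limits in `μ` and in `z` consists of finite sums of products, which is the
trunk-branch form.

The algebra generates the product σ-algebra. In `z` the coordinates are unbounded, but some
difference `σ (t + δ) - σ t` is bounded and not affine (`exists_bounded_difference`), and networks
built from it recover each coordinate as a pointwise limit. In `μ`, integrals of bounded continuous
functions determine all `μ B`, and these generate the Wasserstein Borel σ-algebra
(`borel_le_comap_toMeasure`). The reason is a coupling estimate: countably many masses and truncated
second moments along fine partitions, with the total second moment, control `W2` near a given
measure.

Finally, limits are replaced by actual networks uniformly in `(μ, z)` (`exists_net_tensor_approx`),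
and the resulting sum is written in the required architecture (`exists_deepONetCyl_eq`). -/

/-! ### Ridge approximation in one variable. -/

/-- The span of the dilated translates `t ↦ h (w t + b)`. -/
def ridgeSpan (h : ℝ → ℝ) : Submodule ℝ (ℝ → ℝ) :=
  Submodule.span ℝ (Set.range fun (p : ℝ × ℝ) (t : ℝ) => h (p.1 * t + p.2))

/-- The closure of a space of functions for uniform convergence on compact intervals. -/
def compactClosure (W : Submodule ℝ (ℝ → ℝ)) : Submodule ℝ (ℝ → ℝ) where
  carrier := {f | ∀ C ε : ℝ, 0 < ε → ∃ g ∈ W, ∀ t, |t| ≤ C → |f t - g t| ≤ ε}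
  zero_mem' := fun C ε hε => ⟨0, W.zero_mem, fun t _ => by simp [hε.le]⟩
  add_mem' := by
    intro f₁ f₂ h₁ h₂ C ε hε
    obtain ⟨g₁, hg₁, H₁⟩ := h₁ C (ε / 2) (half_pos hε)
    obtain ⟨g₂, hg₂, H₂⟩ := h₂ C (ε / 2) (half_pos hε)
    refine ⟨g₁ + g₂, W.add_mem hg₁ hg₂, fun t ht => ?_⟩
    have h1 := abs_le.1 (H₁ t ht)
    have h2 := abs_le.1 (H₂ t ht)
    simp only [Pi.add_apply]
    exact abs_le.2 ⟨by linarith, by linarith⟩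
  smul_mem' := by
    intro c f hf C ε hε
    obtain ⟨g, hg, H⟩ := hf C (ε / (|c| + 1)) (by positivity)
    refine ⟨c • g, W.smul_mem c hg, fun t ht => ?_⟩
    simp only [Pi.smul_apply, smul_eq_mul, ← mul_sub, abs_mul]
    calc |c| * |f t - g t| ≤ (|c| + 1) * (ε / (|c| + 1)) := by
          gcongr
          · linarith
          · exact H t ht
      _ = ε := by field_simp

lemma le_compactClosure (W : Submodule ℝ (ℝ → ℝ)) : W ≤ compactClosure W :=
  fun f hf _ _ hε => ⟨f, hf, fun t _ => by simp [hε.le]⟩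

lemma compactClosure_idem {W : Submodule ℝ (ℝ → ℝ)} {f : ℝ → ℝ}
    (hf : f ∈ compactClosure (compactClosure W)) : f ∈ compactClosure W := by
  intro C ε hε
  obtain ⟨g, hg, H⟩ := hf C (ε / 2) (half_pos hε)
  obtain ⟨k, hk, H'⟩ := hg C (ε / 2) (half_pos hε)
  refine ⟨k, hk, fun t ht => ?_⟩
  have h1 := abs_le.1 (H t ht)
  have h2 := abs_le.1 (H' t ht)
  exact abs_le.2 ⟨by linarith, by linarith⟩

lemma comp_affine_mem_ridgeSpan {h f : ℝ → ℝ} (hf : f ∈ ridgeSpan h) (w b : ℝ) :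
    (fun t => f (w * t + b)) ∈ ridgeSpan h := by
  induction hf using Submodule.span_induction with
  | mem f hf =>
    obtain ⟨p, rfl⟩ := hf
    refine Submodule.subset_span ⟨(p.1 * w, p.1 * b + p.2), ?_⟩
    ext t
    simp only
    ring_nf
  | zero => exact Submodule.zero_mem _
  | add f g _ _ hf hg => exact Submodule.add_mem _ hf hg
  | smul c f _ hf => exact Submodule.smul_mem _ c hf

lemma comp_affine_mem_compactClosure {h f : ℝ → ℝ} (hf : f ∈ compactClosure (ridgeSpan h))
    (w b : ℝ) : (fun t => f (w * t + b)) ∈ compactClosure (ridgeSpan h) := by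
  intro C ε hε
  obtain ⟨g, hg, H⟩ := hf (|w| * C + |b|) ε hε
  refine ⟨_, comp_affine_mem_ridgeSpan hg w b, fun t ht => H _ ?_⟩
  calc |w * t + b| ≤ |w * t| + |b| := abs_add_le _ _
    _ = |w| * |t| + |b| := by rw [abs_mul]
    _ ≤ |w| * C + |b| := by gcongr

lemma continuous_of_mem_ridgeSpan {h f : ℝ → ℝ} (hh : Continuous h) (hf : f ∈ ridgeSpan h) :
    Continuous f := by
  induction hf using Submodule.span_induction with
  | mem f hf =>
    obtain ⟨p, rfl⟩ := hf
    fun_prop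
  | zero => exact continuous_const
  | add f g _ _ hf hg => exact hf.add hg
  | smul c f _ hf => exact hf.const_smul c

/-- On a compact interval the average over `s` is a Bochner integral in `C(K, ℝ)` against a
probability measure, so it stays in the closed convex set `closure S`. Continuity of the elements of
`W` makes their restrictions points of `C(K, ℝ)`. -/
lemma integral_mem_compactClosure {W : Submodule ℝ (ℝ → ℝ)} (hW : ∀ f ∈ W, Continuous f)
    {k : ℝ → ℝ → ℝ} (hk : Continuous (Function.uncurry k)) (hkW : ∀ s, k s ∈ compactClosure W) :
    (fun t => ∫ s in Set.Ioc (0 : ℝ) 1, k s t) ∈ compactClosure W := by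
  intro C ε hε
  let K := Set.Icc (-C) C
  let S : Submodule ℝ C(K, ℝ) :=
    { carrier := {F | ∃ g ∈ W, ∀ t : K, F t = g t}
      zero_mem' := ⟨0, W.zero_mem, fun _ => rfl⟩
      add_mem' := by
        rintro F G ⟨f, hf, hF⟩ ⟨g, hg, hG⟩
        exact ⟨f + g, W.add_mem hf hg, fun t => by simp [hF, hG]⟩
      smul_mem' := by
        rintro c F ⟨f, hf, hF⟩
        exact ⟨c • f, W.smul_mem c hf, fun t => by simp [hF]⟩ }
  let κ : C(ℝ, C(K, ℝ)) := ContinuousMap.curry ⟨fun p : ℝ × K => k p.1 p.2, by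
    exact hk.comp (continuous_fst.prodMk (continuous_subtype_val.comp continuous_snd))⟩
  have hκ : ∀ s (t : K), κ s t = k s t := fun _ _ => rfl
  have hmem : ∀ s, κ s ∈ closure (S : Set C(K, ℝ)) := by
    intro s
    refine Metric.mem_closure_iff.2 fun η hη => ?_
    obtain ⟨g, hg, H⟩ := hkW s C (η / 2) (half_pos hη)
    refine ⟨⟨fun t : K => g t, (hW g hg).comp continuous_subtype_val⟩, ⟨g, hg, fun _ => rfl⟩, ?_⟩
    refine lt_of_le_of_lt ((ContinuousMap.dist_le (half_pos hη).le).2 fun t => ?_) (half_lt_self hη)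
    exact H t (abs_le.2 t.2)
  have hint : Integrable κ (volume.restrict (Set.Ioc (0 : ℝ) 1)) :=
    (κ.continuous.integrableOn_Icc (a := 0) (b := 1)).mono_set Set.Ioc_subset_Icc_self
  have : IsProbabilityMeasure (volume.restrict (Set.Ioc (0 : ℝ) 1)) := ⟨by simp⟩
  have hI : ∫ s in Set.Ioc (0 : ℝ) 1, κ s ∈ closure (S : Set C(K, ℝ)) :=
    S.convex.closure.integral_mem isClosed_closure (Filter.Eventually.of_forall hmem) hint
  obtain ⟨F, ⟨g, hg, hF⟩, hd⟩ := Metric.mem_closure_iff.1 hI ε hε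
  refine ⟨g, hg, fun t ht => ?_⟩
  have ht' : t ∈ K := abs_le.1 ht
  have h1 := (ContinuousMap.dist_le hε.le).1 hd.le ⟨t, ht'⟩
  have h2 : (∫ s in Set.Ioc (0 : ℝ) 1, κ s) ⟨t, ht'⟩ = ∫ s in Set.Ioc (0 : ℝ) 1, k s t :=
    ((ContinuousMap.evalCLM ℝ (⟨t, ht'⟩ : K)).integral_comp_comm hint).symm
  rw [h2, hF, Real.dist_eq] at h1
  exact h1

/-- The average of `f` over the segment from `t` to `t + δ`. -/
noncomputable def segmentAverage (δ : ℝ) (f : ℝ → ℝ) (t : ℝ) : ℝ :=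
  ∫ s in Set.Ioc (0 : ℝ) 1, f (t + δ * s)

/-- Averaging gains one derivative, and the new derivative is a difference quotient of `f`. This
replaces mollification: two averages turn a second difference of `h` into a second derivative. -/
lemma hasDerivAt_segmentAverage {δ : ℝ} (hδ : δ ≠ 0) {f : ℝ → ℝ} (hf : Continuous f) (t : ℝ) :
    HasDerivAt (segmentAverage δ f) ((f (t + δ) - f t) / δ) t := by
  have h1 : ∀ t, segmentAverage δ f t
      = ((∫ x in (0 : ℝ)..(t + δ), f x) - ∫ x in (0 : ℝ)..t, f x) / δ := by
    intro t
    rw [segmentAverage, ← intervalIntegral.integral_of_le zero_le_one,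
      intervalIntegral.integral_comp_add_mul _ hδ, intervalIntegral.integral_interval_sub_left
        (hf.intervalIntegrable _ _) (hf.intervalIntegrable _ _)]
    simp [div_eq_inv_mul]
  have h2 : ∀ t, HasDerivAt (fun t => ∫ x in (0 : ℝ)..t, f x) (f t) t := fun t =>
    intervalIntegral.integral_hasDerivAt_right (hf.intervalIntegrable _ _)
      (hf.stronglyMeasurableAtFilter _ _) hf.continuousAt
  rw [funext h1]
  exact ((((h2 (t + δ)).comp_add_const t δ)).sub (h2 t)).div_const δ

lemma segmentAverage_mem {h f : ℝ → ℝ} (hh : Continuous h) (hf : Continuous f)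
    (hfm : f ∈ compactClosure (ridgeSpan h)) (δ : ℝ) :
    segmentAverage δ f ∈ compactClosure (ridgeSpan h) := by
  refine integral_mem_compactClosure (k := fun s t => f (t + δ * s))
    (fun g hg => continuous_of_mem_ridgeSpan hh hg) (by fun_prop) fun s => ?_
  simpa using comp_affine_mem_compactClosure hfm 1 (δ * s)

/-- A function with vanishing second differences that is continuous is affine. -/
lemma exists_affine_of_second_difference {h : ℝ → ℝ} (hh : Continuous h)
    (H : ∀ b δ, h (b + δ + δ) - h (b + δ) - (h (b + δ) - h b) = 0) :
    ∃ a c : ℝ, ∀ t, h t = a * t + c := by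
  have hmid : ∀ x y, 2 * h ((x + y) / 2) = h x + h y := by
    intro x y
    have := H x ((y - x) / 2)
    rw [show x + (y - x) / 2 + (y - x) / 2 = y by ring,
      show x + (y - x) / 2 = (x + y) / 2 by ring] at this
    linarith
  -- Jensen's equation `hmid` makes `h - h 0` additive, and a continuous additive map on the line is
  -- linear.
  let A : ℝ →+ ℝ :=
    { toFun := fun t => h t - h 0
      map_zero' := by simp
      map_add' := by
        intro x y
        have h1 := hmid (2 * x) (2 * y)
        have h2 := hmid (2 * x) 0
        have h3 := hmid (2 * y) 0
        rw [show (2 * x + 2 * y) / 2 = x + y by ring] at h1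
        rw [show (2 * x + 0) / 2 = x by ring] at h2
        rw [show (2 * y + 0) / 2 = y by ring] at h3
        linarith }
  let B := A.toRealLinearMap (hh.sub continuous_const)
  refine ⟨B 1, h 0, fun t => ?_⟩
  have h1 : B t = t * B 1 := by
    conv_lhs => rw [show t = t • (1 : ℝ) by simp]
    rw [map_smul, smul_eq_mul]
  have h2 : B t = h t - h 0 := rfl
  linarith

/-- The remainder `k` has derivative `o(v)`, because the first-order expansion of `g'` at `b`
applies at both `b + v` and `b - v`. The mean value inequality on `|v| ≤ |u|` then bounds `k u`.
Only differentiability of `g'` at the single point `b` is needed. -/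
lemma second_difference_peano {g g' : ℝ → ℝ} {b c : ℝ} (hg : ∀ t, HasDerivAt g (g' t) t)
    (hg' : HasDerivAt g' c b) {ε : ℝ} (hε : 0 < ε) :
    ∃ δ > 0, ∀ u, |u| ≤ δ → |g (b + u) + g (b - u) - 2 * g b - c * u ^ 2| ≤ ε * u ^ 2 := by
  have h0 := (hasDerivAt_iff_isLittleO.1 hg').def (half_pos hε)
  obtain ⟨δ, hδ, hball⟩ := Metric.eventually_nhds_iff.1 h0
  refine ⟨δ / 2, half_pos hδ, fun u hu => ?_⟩
  let k : ℝ → ℝ := fun u => g (b + u) + g (b - u) - 2 * g b - c * u ^ 2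
  let k' : ℝ → ℝ := fun u => g' (b + u) - g' (b - u) - 2 * c * u
  have hk : ∀ u, HasDerivAt k (k' u) u := by
    intro u
    have e1 : HasDerivAt (fun u => g (b + u)) (g' (b + u)) u := (hg (b + u)).comp_const_add b u
    have e2 : HasDerivAt (fun u => g (b - u)) (-g' (b - u)) u := (hg (b - u)).comp_const_sub b u
    have e3 : HasDerivAt (fun u : ℝ => c * u ^ 2) (c * (2 * u)) u := by
      simpa using (hasDerivAt_pow 2 u).const_mul c
    refine (((e1.add e2).sub_const (2 * g b)).sub e3).congr_deriv ?_
    simp only [k']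
    ring
  have hbound : ∀ v ∈ Metric.closedBall (0 : ℝ) |u|, ‖k' v‖ ≤ ε * |u| := by
    intro v hv
    have hv' : |v| ≤ |u| := by simpa using hv
    have a1 := hball (y := b + v) (by simp; linarith)
    have a2 := hball (y := b - v) (by simp; linarith)
    simp only [Real.norm_eq_abs, smul_eq_mul, add_sub_cancel_left, sub_sub_cancel_left,
      abs_neg] at a1 a2
    have : k' v = (g' (b + v) - g' b - v * c) - (g' (b - v) - g' b - -v * c) := by
      simp only [k']; ring
    rw [this, Real.norm_eq_abs]
    refine (abs_sub _ _).trans ?_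
    nlinarith
  have := (convex_closedBall (0 : ℝ) |u|).norm_image_sub_le_of_norm_hasDerivWithin_le
    (f := k) (f' := k') (C := ε * |u|) (fun v _ => (hk v).hasDerivWithinAt) hbound
    (x := 0) (y := u) (by simp) (by simp)
  have hk0 : k 0 = 0 := by simp only [k]; ring_nf
  rw [hk0, sub_zero, sub_zero, Real.norm_eq_abs, Real.norm_eq_abs, mul_assoc, ← sq, sq_abs] at this
  exact this

/-- Squares are locally uniform limits of combinations of dilated translates of any continuous
function that is not affine. -/
theorem sq_mem_compactClosure {h : ℝ → ℝ} (hh : Continuous h)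
    (hna : ¬ ∃ a c : ℝ, ∀ t, h t = a * t + c) :
    (fun t : ℝ => t ^ 2) ∈ compactClosure (ridgeSpan h) := by
  obtain ⟨b, δ, hbδ⟩ : ∃ b δ, h (b + δ + δ) - h (b + δ) - (h (b + δ) - h b) ≠ 0 := by
    by_contra! H
    exact hna (exists_affine_of_second_difference hh H)
  have hδ : δ ≠ 0 := by
    rintro rfl
    simp at hbδ
  have hhm : h ∈ compactClosure (ridgeSpan h) :=
    le_compactClosure _ (Submodule.subset_span ⟨(1, 0), by ext; simp⟩)
  set f := segmentAverage δ h
  have hf : ∀ t, HasDerivAt f ((h (t + δ) - h t) / δ) t := hasDerivAt_segmentAverage hδ hh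
  have hfc : Continuous f := continuous_iff_continuousAt.2 fun t => (hf t).continuousAt
  have hfm : f ∈ compactClosure (ridgeSpan h) := segmentAverage_mem hh hh hhm δ
  set g := segmentAverage δ f
  have hg : ∀ t, HasDerivAt g ((f (t + δ) - f t) / δ) t := hasDerivAt_segmentAverage hδ hfc
  have hgm : g ∈ compactClosure (ridgeSpan h) := segmentAverage_mem hh hfc hfm δ
  have hg' := (((hf (b + δ)).comp_add_const b δ).sub (hf b)).div_const δ
  -- This is the second derivative at `b` of the twice averaged function `g`, namely the nonzero
  -- second difference of `h` divided by `δ ^ 2`.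
  set c := ((h (b + δ + δ) - h (b + δ)) / δ - (h (b + δ) - h b) / δ) / δ with hc
  have hc0 : c ≠ 0 := by
    rw [hc, ← sub_div]
    exact div_ne_zero (div_ne_zero hbδ hδ) hδ
  refine compactClosure_idem fun C ε hε => ?_
  have hC1 : 0 < |C| + 1 := by positivity
  obtain ⟨η, hη, H⟩ := second_difference_peano hg hg'
    (ε := |c| * ε / (|C| + 1) ^ 2) (by positivity)
  -- With this scale, `|t| ≤ C` forces `|u * t| ≤ η`, so the Peano estimate holds on the whole
  -- interval. The rescaled second difference `G / (c * u ^ 2)` is then close to `t ^ 2`.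
  set u := η / (|C| + 1) with hu
  have hu0 : 0 < u := by positivity
  let G : ℝ → ℝ := fun t => g (u * t + b) + g (-u * t + b) - (2 : ℝ) * g (0 * t + b)
  have hG : (c * u ^ 2)⁻¹ • G ∈ compactClosure (ridgeSpan h) := by
    refine Submodule.smul_mem _ _ (Submodule.sub_mem _ (Submodule.add_mem _ ?_ ?_)
      (Submodule.smul_mem _ (2 : ℝ) ?_))
    · exact comp_affine_mem_compactClosure hgm u b
    · exact comp_affine_mem_compactClosure hgm (-u) b
    · exact comp_affine_mem_compactClosure hgm 0 b
  refine ⟨_, hG, fun t ht => ?_⟩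
  have htC : |t| ≤ |C| + 1 := by linarith [le_abs_self C]
  have key := H (u * t) (by
    rw [abs_mul, abs_of_pos hu0, hu]
    calc η / (|C| + 1) * |t| ≤ η / (|C| + 1) * (|C| + 1) := by gcongr
      _ = η := by field_simp)
  have e : t ^ 2 - ((c * u ^ 2)⁻¹ • G) t
      = -((c * u ^ 2)⁻¹ * (g (b + u * t) + g (b - u * t) - 2 * g b - c * (u * t) ^ 2)) := by
    simp only [Pi.smul_apply, smul_eq_mul, G]
    rw [show u * t + b = b + u * t by ring, show -u * t + b = b - u * t by ring,
      show 0 * t + b = b by ring]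
    field_simp
    ring
  rw [e, abs_neg, abs_mul, abs_inv, abs_mul, abs_of_pos (by positivity : 0 < u ^ 2)]
  calc (|c| * u ^ 2)⁻¹ * _ ≤ (|c| * u ^ 2)⁻¹ * (|c| * ε / (|C| + 1) ^ 2 * (u * t) ^ 2) := by
        gcongr
    _ = ε * (|t| ^ 2 / (|C| + 1) ^ 2) := by
        rw [mul_pow, sq_abs]
        have := abs_pos.2 hc0
        field_simp
    _ ≤ ε * 1 := by
        gcongr
        exact div_le_one_of_le₀ (by gcongr) (by positivity)
    _ = ε := mul_one ε

/-- Polarization: `t = ((t + 1)² - (t - 1)²) / 4`. -/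
theorem id_mem_compactClosure {h : ℝ → ℝ} (hh : Continuous h)
    (hna : ¬ ∃ a c : ℝ, ∀ t, h t = a * t + c) :
    (fun t : ℝ => t) ∈ compactClosure (ridgeSpan h) := by
  have h1 := comp_affine_mem_compactClosure (sq_mem_compactClosure hh hna) 1 1
  have h2 := comp_affine_mem_compactClosure (sq_mem_compactClosure hh hna) 1 (-1)
  convert Submodule.smul_mem _ (1 / 4 : ℝ) (Submodule.sub_mem _ h1 h2) using 1
  ext t
  simp only [Pi.smul_apply, Pi.sub_apply, smul_eq_mul]
  ring

/-- A continuous function of at most linear increments that is not a polynomial has a bounded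
difference function that is not affine. -/
theorem exists_bounded_difference {σ : ℝ → ℝ} (hσ : Continuous σ)
    (hgrowth : ∃ L : ℝ, ∀ s t : ℝ, |σ s - σ t| ≤ L * (1 + |s - t|))
    (hpoly : ¬ ∃ P : Polynomial ℝ, ∀ t : ℝ, σ t = P.eval t) :
    ∃ δ : ℝ, (∃ C, ∀ t, |σ (t + δ) - σ t| ≤ C) ∧
      ¬ ∃ a c : ℝ, ∀ t, σ (t + δ) - σ t = a * t + c := by
  obtain ⟨L, hL⟩ := hgrowth
  have hb : ∀ δ t, |σ (t + δ) - σ t| ≤ L * (1 + |δ|) := fun δ t => by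
    simpa using hL (t + δ) t
  by_contra H
  push Not at H
  refine hpoly ?_
  obtain ⟨a, c, hac⟩ := exists_affine_of_second_difference hσ (fun b δ => by
    obtain ⟨a, c, hac⟩ := H δ ⟨_, hb δ⟩
    have ha : a = 0 := by
      by_contra ha
      -- At this point `a * t` equals `L * (1 + |δ|) + |c| + 1`, so `a * t + c` exceeds the bound on
      -- the difference. Bounded affine differences are therefore constant, and the second
      -- differences of `σ` vanish.
      have h1 := hb δ ((L * (1 + |δ|) + |c| + 1) / a)
      rw [hac, mul_div_cancel₀ _ ha] at h1
      linarith [le_abs_self (L * (1 + |δ|) + |c| + 1 + c), neg_abs_le c]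
    rw [hac, hac, ha]
    ring)
  exact ⟨Polynomial.C a * Polynomial.X + Polynomial.C c, fun t => by simp [hac]⟩

/-! ### Syntactic operations on networks. -/

namespace FeedforwardNet

/-- Feed the output of a network through `σ` and a new affine output layer. -/
def append : {m k n : ℕ} → FeedforwardNet m k → Matrix (Fin n) (Fin k) ℝ → (Fin n → ℝ) →
    FeedforwardNet m n
  | _, _, _, .output W b, W', b' => .hidden W b (.output W' b')
  | _, _, _, .hidden W b next, W', b' => .hidden W b (next.append W' b')

/-- Precompose a network with a linear map. -/
def precomp : {m n k : ℕ} → FeedforwardNet m n → Matrix (Fin m) (Fin k) ℝ → FeedforwardNet k n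
  | _, _, _, .output W b, A => .output (W * A) b
  | _, _, _, .hidden W b next, A => .hidden (W * A) b next

/-- Postcompose a network with a linear map. -/
def postcomp : {m n k : ℕ} → FeedforwardNet m n → Matrix (Fin k) (Fin n) ℝ → FeedforwardNet m k
  | _, _, _, .output W b, A => .output (A * W) (A.mulVec b)
  | _, _, _, .hidden W b next, A => .hidden W b (next.postcomp A)

lemma eval_append (σ : ℝ → ℝ) {m k n : ℕ} (N : FeedforwardNet m k)
    (W : Matrix (Fin n) (Fin k) ℝ) (b : Fin n → ℝ) (y : Fin m → ℝ) :
    (N.append W b).eval σ y = W.mulVec (fun i => σ (N.eval σ y i)) + b := by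
  induction N with
  | output => rfl
  | hidden W b next ih => exact ih _ _

lemma eval_precomp (σ : ℝ → ℝ) {m n k : ℕ} (N : FeedforwardNet m n)
    (A : Matrix (Fin m) (Fin k) ℝ) (y : Fin k → ℝ) :
    (N.precomp A).eval σ y = N.eval σ (A.mulVec y) := by
  cases N <;> simp [precomp, eval, Matrix.mulVec_mulVec]

lemma eval_postcomp (σ : ℝ → ℝ) {m n k : ℕ} (N : FeedforwardNet m n)
    (A : Matrix (Fin k) (Fin n) ℝ) (y : Fin m → ℝ) :
    (N.postcomp A).eval σ y = A.mulVec (N.eval σ y) := by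
  induction N with
  | output => simp [postcomp, eval, Matrix.mulVec_mulVec, Matrix.mulVec_add]
  | hidden W b next ih => exact ih _ _

/-- Select input coordinates before applying a network. -/
def selectInputs {m n k : ℕ} (N : FeedforwardNet m n) (s : Fin m → Fin k) : FeedforwardNet k n :=
  N.precomp (Matrix.of fun i j => if s i = j then 1 else 0)

lemma eval_selectInputs (σ : ℝ → ℝ) {m n k : ℕ} (N : FeedforwardNet m n) (s : Fin m → Fin k)
    (y : Fin k → ℝ) : (N.selectInputs s).eval σ y = N.eval σ (fun i => y (s i)) := by
  rw [selectInputs, eval_precomp]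
  congr 1
  ext i
  simp [Matrix.mulVec, dotProduct]

end FeedforwardNet

/-! ### Networks over a family of features, and the algebra of their bounded uniform limits. -/

section NetClass

variable {X κ : Type*}

/-- The functions on `X` computed by networks with `n` hidden layers out of the features `f`. -/
def netClass (σ : ℝ → ℝ) (f : κ → X → ℝ) : ℕ → Submodule ℝ (X → ℝ)
  | 0 => Submodule.span ℝ (insert 1 (Set.range f))
  | n + 1 => Submodule.span ℝ (insert 1 ((fun g x => σ (g x)) '' (netClass σ f n : Set (X → ℝ))))

variable {σ : ℝ → ℝ} {f : κ → X → ℝ}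

lemma one_mem_netClass (n : ℕ) : (1 : X → ℝ) ∈ netClass σ f n := by
  cases n <;> exact Submodule.subset_span (Set.mem_insert _ _)

lemma feature_mem_netClass (k : κ) : f k ∈ netClass σ f 0 :=
  Submodule.subset_span (Set.mem_insert_of_mem _ ⟨k, rfl⟩)

lemma ridgeSpan_comp_mem_netClass {n : ℕ} {g : X → ℝ} (hg : g ∈ netClass σ f n) {p : ℝ → ℝ}
    (hp : p ∈ ridgeSpan σ) : (fun x => p (g x)) ∈ netClass σ f (n + 1) := by
  induction hp using Submodule.span_induction with
  | mem p hp =>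
    obtain ⟨⟨w, b⟩, rfl⟩ := hp
    refine Submodule.subset_span (Set.mem_insert_of_mem _ ⟨w • g + b • (1 : X → ℝ), ?_, ?_⟩)
    · exact Submodule.add_mem _ (Submodule.smul_mem _ _ hg)
        (Submodule.smul_mem _ _ (one_mem_netClass n))
    · ext x
      simp
  | zero => exact Submodule.zero_mem _
  | add p q _ _ hp hq => exact Submodule.add_mem _ hp hq
  | smul c p _ hp => exact Submodule.smul_mem _ c hp

/-- The union of the finite supports gives all the functions a common list of generators. These
become the units of one shared layer, and the coefficients of `1` become its biases. -/
lemma exists_matrix_of_mem_span_insert_one {S : Set (X → ℝ)} {m : ℕ} (g : Fin m → X → ℝ)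
    (hg : ∀ i, g i ∈ Submodule.span ℝ (insert 1 S)) :
    ∃ (k : ℕ) (e : Fin k → S) (W : Matrix (Fin m) (Fin k) ℝ) (b : Fin m → ℝ),
      ∀ x, (fun i => g i x) = W.mulVec (fun j => (e j : X → ℝ) x) + b := by
  classical
  have h : ∀ i, ∃ (c : ℝ) (l : S →₀ ℝ), g i = c • 1 + l.sum fun s a => a • (s : X → ℝ) := by
    intro i
    obtain ⟨c, z, hz, hc⟩ := Submodule.mem_span_insert.1 (hg i)
    rw [← Subtype.range_coe (s := S)] at hz
    obtain ⟨l, rfl⟩ := (Finsupp.mem_span_range_iff_exists_finsupp).1 hz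
    exact ⟨c, l, hc⟩
  choose c l hl using h
  let s : Finset S := Finset.univ.biUnion fun i => (l i).support
  refine ⟨s.card, fun j => s.equivFin.symm j, Matrix.of fun i j => l i (s.equivFin.symm j), c,
    fun x => ?_⟩
  ext i
  have hsub : (l i).support ⊆ s := Finset.subset_biUnion_of_mem (fun i => (l i).support)
    (Finset.mem_univ i)
  simp only [Pi.add_apply, Matrix.mulVec, dotProduct, Matrix.of_apply]
  rw [hl i, Finsupp.sum_of_support_subset _ hsub _ (by simp)]
  rw [Equiv.sum_comp s.equivFin.symm (fun t : s => l i t * (t : S).1 x),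
    Finset.sum_coe_sort s (fun t : S => l i t * (t : S).1 x)]
  simp [Finset.sum_apply, add_comm]

/-- Finitely many functions computed with `n` hidden layers are the outputs of one network. -/
theorem exists_net_of_mem_netClass (n : ℕ) {m : ℕ} (g : Fin m → X → ℝ)
    (hg : ∀ i, g i ∈ netClass σ f n) :
    ∃ (J : ℕ) (s : Fin J → κ) (N : FeedforwardNet J m),
      ∀ x, N.eval σ (fun j => f (s j) x) = fun i => g i x := by
  induction n generalizing m with
  | zero =>
    obtain ⟨k, e, W, b, h⟩ := exists_matrix_of_mem_span_insert_one g hg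
    choose s hs using fun j => (e j).2
    exact ⟨k, s, .output W b, fun x => by simp [h x, hs, FeedforwardNet.eval]⟩
  | succ n ih =>
    obtain ⟨k, e, W, b, h⟩ := exists_matrix_of_mem_span_insert_one g hg
    choose u hu hue using fun j => (e j).2
    obtain ⟨J, s, N, hN⟩ := ih u hu
    refine ⟨J, s, N.append W b, fun x => ?_⟩
    rw [FeedforwardNet.eval_append, hN, h x]
    congr
    ext j
    rw [← hue]

/-- The bounded functions that are uniform limits of functions computed by networks with `n` hidden
layers. -/
def netClosure (σ : ℝ → ℝ) (f : κ → X → ℝ) (n : ℕ) : Submodule ℝ (X → ℝ) where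
  carrier := {h | (∃ C, ∀ x, |h x| ≤ C) ∧
    ∀ ε : ℝ, 0 < ε → ∃ g ∈ netClass σ f n, ∀ x, |h x - g x| ≤ ε}
  zero_mem' := ⟨⟨0, by simp⟩, fun ε hε => ⟨0, Submodule.zero_mem _, by simp [hε.le]⟩⟩
  add_mem' := by
    rintro h₁ h₂ ⟨⟨C₁, hC₁⟩, H₁⟩ ⟨⟨C₂, hC₂⟩, H₂⟩
    refine ⟨⟨C₁ + C₂, fun x => (abs_add_le _ _).trans (add_le_add (hC₁ x) (hC₂ x))⟩,
      fun ε hε => ?_⟩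
    obtain ⟨g₁, hg₁, K₁⟩ := H₁ (ε / 2) (half_pos hε)
    obtain ⟨g₂, hg₂, K₂⟩ := H₂ (ε / 2) (half_pos hε)
    refine ⟨g₁ + g₂, Submodule.add_mem _ hg₁ hg₂, fun x => ?_⟩
    have h1 := abs_le.1 (K₁ x)
    have h2 := abs_le.1 (K₂ x)
    simp only [Pi.add_apply]
    exact abs_le.2 ⟨by linarith, by linarith⟩
  smul_mem' := by
    rintro c h ⟨⟨C, hC⟩, H⟩
    refine ⟨⟨|c| * C, fun x => ?_⟩, fun ε hε => ?_⟩
    · simp only [Pi.smul_apply, smul_eq_mul, abs_mul]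
      gcongr
      exact hC x
    obtain ⟨g, hg, K⟩ := H (ε / (|c| + 1)) (by positivity)
    refine ⟨c • g, Submodule.smul_mem _ c hg, fun x => ?_⟩
    simp only [Pi.smul_apply, smul_eq_mul, ← mul_sub, abs_mul]
    calc |c| * |h x - g x| ≤ (|c| + 1) * (ε / (|c| + 1)) := by
          gcongr
          · linarith
          · exact K x
      _ = ε := by field_simp

lemma mem_netClosure_of_mem_netClass {n : ℕ} {h : X → ℝ} (hh : h ∈ netClass σ f n)
    (hb : ∃ C, ∀ x, |h x| ≤ C) : h ∈ netClosure σ f n :=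
  ⟨hb, fun ε hε => ⟨h, hh, by simp [hε.le]⟩⟩

/-- Boundedness of `h` is what makes approximation of `p` on compact intervals sufficient. The
window `C + 1` also contains the values of any network within distance 1 of `h`. -/
lemma comp_mem_netClosure {n : ℕ} {h : X → ℝ} (hh : h ∈ netClosure σ f n) {p : ℝ → ℝ}
    (hpc : Continuous p) (hp : p ∈ compactClosure (ridgeSpan σ)) :
    (fun x => p (h x)) ∈ netClosure σ f (n + 1) := by
  obtain ⟨⟨C, hC⟩, H⟩ := hh
  refine ⟨?_, fun ε hε => ?_⟩
  · obtain ⟨D, hD⟩ := (isCompact_Icc (a := -C) (b := C)).exists_bound_of_continuousOn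
      hpc.continuousOn
    exact ⟨D, fun x => hD _ (abs_le.1 (hC x))⟩
  obtain ⟨q, hq, hqp⟩ := hp (C + 1) (ε / 2) (half_pos hε)
  obtain ⟨δ, hδ, hu⟩ := Metric.uniformContinuousOn_iff.1
    ((isCompact_Icc (a := -(C + 1)) (b := C + 1)).uniformContinuousOn_of_continuous
      hpc.continuousOn) (ε / 2) (half_pos hε)
  obtain ⟨g, hg, hgh⟩ := H (min (δ / 2) 1) (lt_min (half_pos hδ) one_pos)
  refine ⟨_, ridgeSpan_comp_mem_netClass hg hq, fun x => ?_⟩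
  have h1 : |h x - g x| ≤ 1 := (hgh x).trans (min_le_right _ _)
  have h2 : |h x - g x| ≤ δ / 2 := (hgh x).trans (min_le_left _ _)
  have h3 : |g x| ≤ C + 1 := by
    have := abs_le.1 h1
    have := abs_le.1 (hC x)
    exact abs_le.2 ⟨by linarith, by linarith⟩
  have h4 : |h x| ≤ C + 1 := (hC x).trans (by linarith)
  have h5 := hu (h x) (abs_le.1 h4) (g x) (abs_le.1 h3) (by rw [Real.dist_eq]; linarith)
  rw [Real.dist_eq] at h5
  have h6 := abs_le.1 (hqp _ h3)
  have h7 := abs_le.1 h5.le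
  exact abs_le.2 ⟨by linarith, by linarith⟩

section Algebra

variable (hσ : Continuous σ) (hna : ¬ ∃ a c : ℝ, ∀ t, σ t = a * t + c)
include hσ hna

/-- An extra hidden layer can approximate the identity, so depths can be equalized before adding or
multiplying. -/
lemma netClosure_mono {m n : ℕ} (hmn : m ≤ n) : netClosure σ f m ≤ netClosure σ f n :=
  monotone_nat_of_le_succ (f := netClosure σ f) (fun _ _ hh =>
    comp_mem_netClosure hh continuous_id (id_mem_compactClosure hσ hna)) hmn

lemma mul_mem_netClosure {n : ℕ} {g h : X → ℝ} (hg : g ∈ netClosure σ f n)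
    (hh : h ∈ netClosure σ f n) : g * h ∈ netClosure σ f (n + 1) := by
  have h1 := comp_mem_netClosure (Submodule.add_mem _ hg hh) (continuous_pow 2)
    (sq_mem_compactClosure hσ hna)
  have h2 := comp_mem_netClosure (Submodule.sub_mem _ hg hh) (continuous_pow 2)
    (sq_mem_compactClosure hσ hna)
  convert Submodule.smul_mem _ (1 / 4 : ℝ) (Submodule.sub_mem _ h1 h2) using 1
  ext x
  simp only [Pi.mul_apply, Pi.smul_apply, Pi.sub_apply, Pi.add_apply, smul_eq_mul]
  ring

end Algebra

/-- The algebra of bounded functions that are uniform limits of functions computed by networks of a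
fixed depth. -/
def netAlgebra (f : κ → X → ℝ) (hσ : Continuous σ)
    (hna : ¬ ∃ a c : ℝ, ∀ t, σ t = a * t + c) : Subalgebra ℝ (X → ℝ) where
  carrier := {h | ∃ n, h ∈ netClosure σ f n}
  mul_mem' := by
    rintro g h ⟨m, hg⟩ ⟨n, hh⟩
    exact ⟨_, mul_mem_netClosure hσ hna (netClosure_mono hσ hna (le_max_left m n) hg)
      (netClosure_mono hσ hna (le_max_right m n) hh)⟩
  add_mem' := by
    rintro g h ⟨m, hg⟩ ⟨n, hh⟩
    exact ⟨_, Submodule.add_mem _ (netClosure_mono hσ hna (le_max_left m n) hg)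
      (netClosure_mono hσ hna (le_max_right m n) hh)⟩
  algebraMap_mem' := fun c => ⟨0, mem_netClosure_of_mem_netClass
    (by rw [Algebra.algebraMap_eq_smul_one]; exact Submodule.smul_mem _ c (one_mem_netClass 0))
    ⟨|c|, fun x => by simp⟩⟩

lemma mem_netAlgebra {hσ : Continuous σ} {hna : ¬ ∃ a c : ℝ, ∀ t, σ t = a * t + c} {h : X → ℝ} :
    h ∈ netAlgebra f hσ hna ↔ ∃ n, h ∈ netClosure σ f n := Iff.rfl

lemma netAlgebra_bounded {hσ : Continuous σ} {hna : ¬ ∃ a c : ℝ, ∀ t, σ t = a * t + c} {h : X → ℝ}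
    (hh : h ∈ netAlgebra f hσ hna) : ∃ C, ∀ x, |h x| ≤ C := hh.choose_spec.1

/-- This lets the bounded difference of `σ` act as an activation while the networks still use only
`σ`. -/
lemma ridgeSpan_difference_le (δ : ℝ) :
    ridgeSpan (fun t => σ (t + δ) - σ t) ≤ ridgeSpan σ := by
  refine Submodule.span_le.2 ?_
  rintro _ ⟨p, rfl⟩
  refine Submodule.sub_mem _ (Submodule.subset_span ⟨(p.1, p.2 + δ), ?_⟩)
    (Submodule.subset_span ⟨p, rfl⟩)
  ext t
  simp [add_assoc]

lemma bounded_of_mem_ridgeSpan {h p : ℝ → ℝ} (hb : ∃ C, ∀ t, |h t| ≤ C) (hp : p ∈ ridgeSpan h) :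
    ∃ C, ∀ t, |p t| ≤ C := by
  induction hp using Submodule.span_induction with
  | mem p hp =>
    obtain ⟨p, rfl⟩ := hp
    exact hb.imp fun C hC t => hC _
  | zero => exact ⟨0, by simp⟩
  | add p q _ _ hp hq =>
    obtain ⟨C, hC⟩ := hp
    obtain ⟨D, hD⟩ := hq
    exact ⟨C + D, fun t => (abs_add_le _ _).trans (add_le_add (hC t) (hD t))⟩
  | smul c p _ hp =>
    obtain ⟨C, hC⟩ := hp
    refine ⟨|c| * C, fun t => ?_⟩
    simp only [Pi.smul_apply, smul_eq_mul, abs_mul]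
    gcongr
    exact hC t

/-- The network algebra sees every feature, even the unbounded ones, as a pointwise limit. -/
lemma measurable_feature_of_netAlgebra (hσ : Continuous σ)
    (hna : ¬ ∃ a c : ℝ, ∀ t, σ t = a * t + c)
    (hgrowth : ∃ L : ℝ, ∀ s t : ℝ, |σ s - σ t| ≤ L * (1 + |s - t|))
    (hpoly : ¬ ∃ P : Polynomial ℝ, ∀ t : ℝ, σ t = P.eval t)
    {m : MeasurableSpace X} (hm : ∀ h ∈ netAlgebra f hσ hna, Measurable h) (k : κ) :
    Measurable (f k) := by
  obtain ⟨δ, hb, hψ⟩ := exists_bounded_difference hσ hgrowth hpoly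
  have hid := id_mem_compactClosure (h := fun t => σ (t + δ) - σ t) (by fun_prop) hψ
  -- Here `p n` is within `1 / (n + 1)` of the identity on `[-n, n]` and bounded on the whole line.
  -- Hence `p n (f k x)` is a bounded network with one hidden layer, and it tends to `f k x` for
  -- every `x`.
  choose p hp hpid using fun n : ℕ => hid n (1 / (n + 1)) (by positivity)
  refine measurable_of_tendsto_metrizable (f := fun n x => p n (f k x)) (fun n => hm _ ⟨1,
    mem_netClosure_of_mem_netClass
      (ridgeSpan_comp_mem_netClass (feature_mem_netClass k) (ridgeSpan_difference_le δ (hp n))) ?_⟩)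
    (tendsto_pi_nhds.2 fun x => ?_)
  · obtain ⟨C, hC⟩ := bounded_of_mem_ridgeSpan hb (hp n)
    exact ⟨C, fun x => hC _⟩
  · refine tendsto_iff_dist_tendsto_zero.2 (squeeze_zero' (Filter.Eventually.of_forall fun _ =>
      dist_nonneg) ?_ tendsto_one_div_add_atTop_nhds_zero_nat)
    filter_upwards [Filter.eventually_ge_atTop ⌈|f k x|⌉₊] with n hn
    rw [dist_comm, Real.dist_eq]
    exact hpid n _ (Nat.ceil_le.1 hn)

end NetClass

/-! ### Density in `L²` of an algebra generating the σ-algebra. -/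

section Density

variable {X : Type*} [mX : MeasurableSpace X]

/-- `f` is a limit in `L²(P)` of elements of `A`. -/
def L2Approx (P : Measure X) (A : Subalgebra ℝ (X → ℝ)) (f : X → ℝ) : Prop :=
  ∀ ε : ℝ≥0∞, ε ≠ 0 → ∃ a ∈ A, eLpNorm (a - f) 2 P ≤ ε

variable {P : Measure X} {A : Subalgebra ℝ (X → ℝ)}

lemma L2Approx.of_close (hm : ∀ a ∈ A, Measurable a) {f : X → ℝ} (hf : Measurable f)
    (h : ∀ ε : ℝ≥0∞, ε ≠ 0 → ∃ g, Measurable g ∧ L2Approx P A g ∧ eLpNorm (g - f) 2 P ≤ ε) :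
    L2Approx P A f := by
  intro ε hε
  have hε2 : ε / 2 ≠ 0 := (ENNReal.half_pos hε).ne'
  obtain ⟨g, hg, hgA, hgf⟩ := h _ hε2
  obtain ⟨a, ha, hag⟩ := hgA _ hε2
  refine ⟨a, ha, ?_⟩
  calc eLpNorm (a - f) 2 P = eLpNorm ((a - g) + (g - f)) 2 P := by rw [sub_add_sub_cancel]
    _ ≤ eLpNorm (a - g) 2 P + eLpNorm (g - f) 2 P :=
        eLpNorm_add_le ((hm a ha).sub hg).aestronglyMeasurable (hg.sub hf).aestronglyMeasurable
          one_le_two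
    _ ≤ ε / 2 + ε / 2 := add_le_add hag hgf
    _ = ε := ENNReal.add_halves ε

lemma tendsto_eLpNorm_two_of_bounded [IsProbabilityMeasure P] {f : ℕ → X → ℝ} {g : X → ℝ} {C : ℝ}
    (hf : ∀ n, Measurable (f n)) (hg : Measurable g) (hC : ∀ n x, |f n x - g x| ≤ C)
    (h : ∀ x, Filter.Tendsto (fun n => f n x) Filter.atTop (nhds (g x))) :
    Filter.Tendsto (fun n => eLpNorm (f n - g) 2 P) Filter.atTop (nhds 0) := by
  have h1 : Filter.Tendsto (fun n => ∫⁻ x, ‖f n x - g x‖ₑ ^ (2 : ℝ) ∂P) Filter.atTop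
      (nhds (∫⁻ _, 0 ∂P)) := by
    refine tendsto_lintegral_of_dominated_convergence (fun _ => ENNReal.ofReal C ^ (2 : ℝ))
      (fun n => ((hf n).sub hg).enorm.pow_const _) (fun n => Filter.Eventually.of_forall fun x => ?_)
      (by simp) (Filter.Eventually.of_forall fun x => ?_)
    · dsimp only
      gcongr
      rw [← ofReal_norm]
      exact ENNReal.ofReal_le_ofReal (hC n x)
    · have h2 := ((h x).sub_const (g x)).enorm
      rw [sub_self, enorm_zero] at h2
      simpa using h2.ennrpow_const 2
  rw [lintegral_zero] at h1
  have h3 := h1.ennrpow_const (1 / 2)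
  rw [ENNReal.zero_rpow_of_pos (by norm_num)] at h3
  refine h3.congr fun n => ?_
  rw [eLpNorm_eq_lintegral_rpow_enorm_toReal (by simp) (by simp)]
  simp

lemma L2Approx.of_tendsto [IsProbabilityMeasure P] (hm : ∀ a ∈ A, Measurable a) {f : ℕ → X → ℝ}
    {g : X → ℝ} {C : ℝ} (hf : ∀ n, Measurable (f n)) (hg : Measurable g)
    (hC : ∀ n x, |f n x - g x| ≤ C)
    (h : ∀ x, Filter.Tendsto (fun n => f n x) Filter.atTop (nhds (g x)))
    (hfA : ∀ n, L2Approx P A (f n)) : L2Approx P A g := by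
  refine L2Approx.of_close hm hg fun ε hε => ?_
  obtain ⟨n, hn⟩ := ((tendsto_eLpNorm_two_of_bounded (P := P) hf hg hC h).eventually
    (ge_mem_nhds (pos_iff_ne_zero.2 hε))).exists
  exact ⟨f n, hf n, hfA n, hn⟩

lemma L2Approx.one_sub {f : X → ℝ} (hf : L2Approx P A f) : L2Approx P A (1 - f) := by
  intro ε hε
  obtain ⟨a, ha, h⟩ := hf ε hε
  refine ⟨1 - a, A.sub_mem A.one_mem ha, ?_⟩
  rwa [sub_sub_sub_cancel_left, eLpNorm_sub_comm]

/-- Write `a b - f g = (a - f) g + a (b - g)`. The first term uses `|g| ≤ 1`. The second uses the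
sup bound of `a`, so `b` must be chosen after `a`. -/
lemma L2Approx.mul (hb : ∀ a ∈ A, ∃ C : ℝ, ∀ x, |a x| ≤ C) (hm : ∀ a ∈ A, Measurable a)
    {f g : X → ℝ} (hfm : Measurable f) (hgm : Measurable g) (hg1 : ∀ x, |g x| ≤ 1)
    (hf : L2Approx P A f) (hg : L2Approx P A g) : L2Approx P A (f * g) := by
  intro ε hε
  obtain ⟨a, ha, haf⟩ := hf (ε / 2) (ENNReal.half_pos hε).ne'
  obtain ⟨C, hC⟩ := hb a ha
  have hC1 : 0 < |C| + 1 := by positivity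
  obtain ⟨b, hbA, hbg⟩ := hg (ε / 2 / ENNReal.ofReal (|C| + 1))
    (ENNReal.div_pos (ENNReal.half_pos hε).ne' ENNReal.ofReal_ne_top).ne'
  refine ⟨a * b, A.mul_mem ha hbA, ?_⟩
  have h1 : eLpNorm ((a - f) * g) 2 P ≤ ε / 2 := by
    refine (eLpNorm_mono fun x => ?_).trans haf
    simp only [Pi.mul_apply, norm_mul]
    exact mul_le_of_le_one_right (norm_nonneg _) (hg1 x)
  have h2 : eLpNorm (a * (b - g)) 2 P ≤ ε / 2 := by
    refine (eLpNorm_le_mul_eLpNorm_of_ae_le_mul (c := |C| + 1) (g := b - g)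
      (Filter.Eventually.of_forall fun x => ?_) 2).trans ?_
    · simp only [Pi.mul_apply, norm_mul]
      gcongr
      exact (hC x).trans (by linarith [le_abs_self C])
    · calc ENNReal.ofReal (|C| + 1) * eLpNorm (b - g) 2 P
          ≤ ENNReal.ofReal (|C| + 1) * (ε / 2 / ENNReal.ofReal (|C| + 1)) := by gcongr
        _ = ε / 2 := ENNReal.mul_div_cancel (by simpa using hC1) ENNReal.ofReal_ne_top
  calc eLpNorm (a * b - f * g) 2 P = eLpNorm ((a - f) * g + a * (b - g)) 2 P := by
        congr 1; ring
    _ ≤ eLpNorm ((a - f) * g) 2 P + eLpNorm (a * (b - g)) 2 P :=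
        eLpNorm_add_le (((hm a ha).sub hfm).mul hgm).aestronglyMeasurable
          ((hm a ha).mul ((hm b hbA).sub hgm)).aestronglyMeasurable one_le_two
    _ ≤ ε / 2 + ε / 2 := add_le_add h1 h2
    _ = ε := ENNReal.add_halves ε

/-- Weierstrass on an interval containing the range of `a`: polynomials in `a` stay in the algebra,
and a uniform error bounds the `L²` error because `P` has mass one. -/
lemma L2Approx.comp_continuous [IsProbabilityMeasure P] (hb : ∀ a ∈ A, ∃ C : ℝ, ∀ x, |a x| ≤ C)
    {a : X → ℝ} (ha : a ∈ A) {F : ℝ → ℝ} (hF : Continuous F) :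
    L2Approx P A (fun x => F (a x)) := by
  intro ε hε
  obtain ⟨C, hC⟩ := hb a ha
  obtain ⟨r, hr, hrε⟩ : ∃ r : ℝ, 0 < r ∧ ENNReal.ofReal r ≤ ε := by
    rcases eq_or_ne ε ∞ with rfl | h
    · exact ⟨1, one_pos, le_top⟩
    · exact ⟨ε.toReal, ENNReal.toReal_pos hε h, ENNReal.ofReal_toReal_le⟩
  obtain ⟨p, hp⟩ := exists_polynomial_near_of_continuousOn (-C) C F hF.continuousOn r hr
  refine ⟨Polynomial.aeval a p, ?_, ?_⟩
  · exact (Algebra.adjoin_le (S := A) (by simpa using ha))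
      (Polynomial.aeval_mem_adjoin_singleton ℝ a)
  · refine (eLpNorm_le_of_ae_bound (C := r) (Filter.Eventually.of_forall fun x => ?_)).trans ?_
    · simp only [Pi.sub_apply, Polynomial.aeval_fn_apply, Real.norm_eq_abs]
      exact (hp _ (abs_le.1 (hC x))).le
    · simpa using hrε

/-- If an algebra of bounded measurable functions generates the σ-algebra, then
it approximates the indicators of all measurable sets in `L²`. -/
theorem L2Approx.indicator [IsProbabilityMeasure P] (hb : ∀ a ∈ A, ∃ C : ℝ, ∀ x, |a x| ≤ C)
    (hm : ∀ a ∈ A, Measurable a)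
    (hgen : ∀ m' : MeasurableSpace X, (∀ a ∈ A, Measurable[m'] a) → mX ≤ m')
    {s : Set X} (hs : MeasurableSet s) : L2Approx P A (s.indicator 1) := by
  have hmeas : ∀ s : Set X, MeasurableSet s → Measurable (s.indicator (1 : X → ℝ)) :=
    fun s hs => measurable_one.indicator hs
  have hle : ∀ (s : Set X) x, |s.indicator (1 : X → ℝ) x| ≤ 1 := by
    intro s x
    by_cases h : x ∈ s <;> simp [h]
  have hcompl : ∀ s : Set X, sᶜ.indicator (1 : X → ℝ) = 1 - s.indicator 1 :=
    fun s => Set.indicator_compl s 1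
  have hdist : ∀ (s t : Set X) x, |s.indicator (1 : X → ℝ) x - t.indicator 1 x| ≤ 2 :=
    fun s t x => (abs_sub _ _).trans (by linarith [hle s x, hle t x])
  have hinter : ∀ s t : Set X, MeasurableSet s → MeasurableSet t →
      L2Approx P A (s.indicator 1) → L2Approx P A (t.indicator 1) →
      L2Approx P A ((s ∩ t).indicator 1) := by
    intro s t hs ht h1 h2
    rw [Set.inter_indicator_one]
    exact h1.mul hb hm (hmeas s hs) (hmeas t ht) (hle t) h2
  have hunion : ∀ s t : Set X, MeasurableSet s → MeasurableSet t →
      L2Approx P A (s.indicator 1) → L2Approx P A (t.indicator 1) →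
      L2Approx P A ((s ∪ t).indicator 1) := by
    intro s t hs ht h1 h2
    rw [← compl_compl (s ∪ t), Set.compl_union, hcompl]
    refine L2Approx.one_sub (hinter _ _ hs.compl ht.compl ?_ ?_)
    · rw [hcompl]; exact h1.one_sub
    · rw [hcompl]; exact h2.one_sub
  have hIio : ∀ a ∈ A, ∀ c, MeasurableSet (a ⁻¹' Set.Iio c) ∧
      L2Approx P A ((a ⁻¹' Set.Iio c).indicator 1) := by
    intro a ha c
    have hms : MeasurableSet (a ⁻¹' Set.Iio c) := hm a ha measurableSet_Iio
    refine ⟨hms, ?_⟩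
    -- Continuous ramps that increase to the indicator of `Iio c`: zero for `t ≥ c` and one once `n
    -- * (c - t) ≥ 1`.
    let F : ℕ → ℝ → ℝ := fun n t => max 0 (min 1 (n * (c - t)))
    have hF : ∀ n, Continuous (F n) := fun n => by fun_prop
    refine L2Approx.of_tendsto (f := fun n x => F n (a x)) (C := 2) hm
      (fun n => (hF n).measurable.comp (hm a ha)) (hmeas _ hms) (fun n x => ?_) (fun x => ?_)
      (fun n => L2Approx.comp_continuous hb ha (hF n))
    · refine (abs_sub _ _).trans ?_
      have h1 : |F n (a x)| ≤ 1 := by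
        rw [abs_of_nonneg (le_max_left _ _)]
        exact max_le zero_le_one (min_le_left _ _)
      linarith [hle (a ⁻¹' Set.Iio c) x]
    · by_cases hx : a x < c
      · rw [Set.indicator_of_mem (show x ∈ a ⁻¹' Set.Iio c from hx)]
        refine tendsto_const_nhds.congr' ?_
        filter_upwards [Filter.eventually_ge_atTop ⌈1 / (c - a x)⌉₊] with n hn
        have h1 : 0 < c - a x := sub_pos.2 hx
        have h2 := Nat.ceil_le.1 hn
        rw [div_le_iff₀ h1] at h2
        simp [F, min_eq_left h2]
      · rw [Set.indicator_of_notMem (show x ∉ a ⁻¹' Set.Iio c from hx)]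
        refine tendsto_const_nhds.congr fun n => ?_
        have : (n : ℝ) * (c - a x) ≤ 0 := mul_nonpos_of_nonneg_of_nonpos n.cast_nonneg (by linarith)
        simp only [F]
        rw [max_eq_left ((min_le_right _ _).trans this)]
  -- The sets with approximable indicators already form a σ-algebra, since products give
  -- intersections and dominated convergence along partial unions gives countable unions. It makes
  -- every element of `A` measurable by `hIio`, so it is everything by `hgen`.
  let m' : MeasurableSpace X :=
    { MeasurableSet' := fun s => MeasurableSet s ∧ L2Approx P A (s.indicator 1)
      measurableSet_empty := ⟨MeasurableSet.empty, fun ε _ => ⟨0, A.zero_mem, by simp⟩⟩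
      measurableSet_compl := fun s hs => ⟨hs.1.compl, by rw [hcompl]; exact hs.2.one_sub⟩
      measurableSet_iUnion := by
        intro s hs
        have hS : ∀ n, MeasurableSet (Set.accumulate s n) := fun n =>
          MeasurableSet.biUnion (Set.to_countable _) fun i _ => (hs i).1
        have hacc : ∀ n, L2Approx P A ((Set.accumulate s n).indicator 1) := by
          intro n
          induction n with
          | zero => simpa using (hs 0).2
          | succ n ih =>
            rw [Set.accumulate_succ]
            exact hunion _ _ (hS n) (hs _).1 ih (hs _).2
        refine ⟨MeasurableSet.iUnion fun i => (hs i).1, ?_⟩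
        refine L2Approx.of_tendsto hm (fun n => hmeas _ (hS n))
          (hmeas _ (MeasurableSet.iUnion fun i => (hs i).1)) (fun n x => hdist _ _ x)
          (fun x => ?_) hacc
        rw [← Set.iUnion_accumulate]
        exact (Set.monotone_accumulate.tendsto_indicator _ 1 x).mono_right
          (pure_le_nhds _) }
  exact (hgen m' (fun a ha => measurable_of_Iio fun c => hIio a ha c) s hs).2

/-- Combinations `∑ aᵢ • cᵢ` with `aᵢ` in a generating algebra are dense in `L²(P; F)`. -/
theorem exists_mem_span_eLpNorm_sub_le [IsProbabilityMeasure P]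
    {F : Type*} [NormedAddCommGroup F] [NormedSpace ℝ F]
    (hb : ∀ a ∈ A, ∃ C : ℝ, ∀ x, |a x| ≤ C) (hm : ∀ a ∈ A, Measurable a)
    (hgen : ∀ m' : MeasurableSpace X, (∀ a ∈ A, Measurable[m'] a) → mX ≤ m')
    {f : X → F} (hf : MemLp f 2 P) {ε : ℝ≥0∞} (hε : ε ≠ 0) :
    ∃ g ∈ Submodule.span ℝ {g : X → F | ∃ a ∈ A, ∃ c, g = fun x => a x • c},
      StronglyMeasurable g ∧ eLpNorm (f - g) 2 P ≤ ε := by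
  have hsm : ∀ a ∈ A, ∀ c : F, StronglyMeasurable fun x => a x • c := fun a ha c =>
    (hm a ha).stronglyMeasurable.smul_const c
  have hind : ∀ (c : F) ⦃s : Set X⦄, MeasurableSet s → P s < ∞ → ∀ {ε : ℝ≥0∞}, ε ≠ 0 →
      ∃ g : X → F, eLpNorm (g - s.indicator fun _ => c) 2 P ≤ ε ∧
        (g ∈ Submodule.span ℝ {g : X → F | ∃ a ∈ A, ∃ c, g = fun x => a x • c} ∧
          StronglyMeasurable g) := by
    intro c s hs _ ε hε
    have hc : ENNReal.ofReal (‖c‖ + 1) ≠ 0 := by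
      simp only [ne_eq, ENNReal.ofReal_eq_zero, not_le]
      positivity
    obtain ⟨a, ha, has⟩ := L2Approx.indicator (P := P) hb hm hgen hs (ε / ENNReal.ofReal (‖c‖ + 1))
      (ENNReal.div_pos hε ENNReal.ofReal_ne_top).ne'
    refine ⟨fun x => a x • c, ?_, Submodule.subset_span ⟨a, ha, c, rfl⟩, hsm a ha c⟩
    refine (eLpNorm_le_mul_eLpNorm_of_ae_le_mul (c := ‖c‖ + 1) (g := a - s.indicator 1)
        (Filter.Eventually.of_forall fun x => ?_) 2).trans ?_
    · have : ((fun x => a x • c) - s.indicator fun _ => c) x = (a - s.indicator (1 : X → ℝ)) x • c := by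
        by_cases hx : x ∈ s <;> simp [hx, sub_smul]
      rw [this, norm_smul, mul_comm]
      gcongr
      linarith
    · calc ENNReal.ofReal (‖c‖ + 1) * eLpNorm (a - s.indicator 1) 2 P
          ≤ ENNReal.ofReal (‖c‖ + 1) * (ε / ENNReal.ofReal (‖c‖ + 1)) := by gcongr
        _ = ε := ENNReal.mul_div_cancel hc ENNReal.ofReal_ne_top
  obtain ⟨g, hg, hgs⟩ := hf.induction_dense (by simp) (fun g : X → F =>
    g ∈ Submodule.span ℝ {g : X → F | ∃ a ∈ A, ∃ c, g = fun x => a x • c} ∧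
      StronglyMeasurable g) hind (fun f g hf hg => ⟨Submodule.add_mem _ hf.1 hg.1, hf.2.add hg.2⟩)
      (fun f hf => hf.2.aestronglyMeasurable) hε
  exact ⟨g, hgs.1, hgs.2, hg⟩

end Density

/-! ### Couplings adapted to a partition. -/

section Coupling

variable {Z : Type*} [MeasurableSpace Z]

/-- The product coupling of two finite measures of the same mass. -/
noncomputable def productCoupling (α β : Measure Z) : Measure (Z × Z) :=
  (α Set.univ)⁻¹ • α.prod β

lemma map_fst_productCoupling (α β : Measure Z) [IsFiniteMeasure α] [IsFiniteMeasure β]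
    (h : α Set.univ = β Set.univ) : (productCoupling α β).map Prod.fst = α := by
  rw [productCoupling, Measure.map_smul, Measure.map_fst_prod, ← h, smul_smul]
  -- In the massless case the normalizing scalar is `∞`, but the measure it multiplies is zero.
  rcases eq_or_ne (α Set.univ) 0 with h0 | h0
  · rw [Measure.measure_univ_eq_zero.1 h0, smul_zero]
  · rw [ENNReal.inv_mul_cancel h0 (measure_ne_top _ _), one_smul]

lemma map_snd_productCoupling (α β : Measure Z) [IsFiniteMeasure α] [IsFiniteMeasure β]
    (h : α Set.univ = β Set.univ) : (productCoupling α β).map Prod.snd = β := by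
  rw [productCoupling, Measure.map_smul, Measure.map_snd_prod, smul_smul]
  rcases eq_or_ne (α Set.univ) 0 with h0 | h0
  · rw [Measure.measure_univ_eq_zero.1 (h.symm.trans h0), smul_zero]
  · rw [ENNReal.inv_mul_cancel h0 (measure_ne_top _ _), one_smul]

lemma sum_smul_restrict_le {ι : Type*} (s : Finset ι) {A : ι → Set Z}
    (hA : ∀ i, MeasurableSet (A i)) (hd : Pairwise (Function.onFun Disjoint A)) (μ : Measure Z)
    {a : ι → ℝ≥0∞} (ha : ∀ i, a i ≤ 1) : ∑ i ∈ s, a i • μ.restrict (A i) ≤ μ := by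
  refine Measure.le_iff.2 fun B hB => ?_
  calc (∑ i ∈ s, a i • μ.restrict (A i)) B = ∑ i ∈ s, a i * μ (B ∩ A i) := by
        simp [Measure.finsetSum_apply, Measure.restrict_apply hB]
    _ ≤ ∑ i ∈ s, μ (B ∩ A i) := Finset.sum_le_sum fun i _ => mul_le_of_le_one_left' (ha i)
    _ = μ (⋃ i ∈ s, B ∩ A i) := (measure_biUnion_finset (fun i _ j _ hij =>
        (hd hij).mono Set.inter_subset_right Set.inter_subset_right)
        fun i _ => hB.inter (hA i)).symm
    _ ≤ μ B := measure_mono (Set.iUnion₂_subset fun i _ => Set.inter_subset_left)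

/-- Two probability measures are coupled by matching the masses `aᵢ μ(Aᵢ) = bᵢ ν(Aᵢ)` inside each
piece `Aᵢ` and pairing the remaining masses independently. -/
theorem exists_coupling_of_partition {ι : Type*} (s : Finset ι) {A : ι → Set Z}
    (hA : ∀ i, MeasurableSet (A i)) (hd : Pairwise (Function.onFun Disjoint A))
    (μ ν : Measure Z) [IsProbabilityMeasure μ] [IsProbabilityMeasure ν]
    {a b : ι → ℝ≥0∞} (ha : ∀ i, a i ≤ 1) (hb : ∀ i, b i ≤ 1)
    (hab : ∀ i, a i * μ (A i) = b i * ν (A i))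
    {c : Z × Z → ℝ≥0∞} {q : Z → ℝ≥0∞} (hq : Measurable q)
    (hcq : ∀ p, c p ≤ 2 * (q p.1 + q p.2)) {D : ℝ≥0∞}
    (hcD : ∀ i, ∀ p : Z × Z, p.1 ∈ A i → p.2 ∈ A i → c p ≤ D) :
    ∃ π : Measure (Z × Z), π.map Prod.fst = μ ∧ π.map Prod.snd = ν ∧
      ∫⁻ p, c p ∂π + 2 * ∑ i ∈ s, a i * ∫⁻ z in A i, q z ∂μ
        + 2 * ∑ i ∈ s, b i * ∫⁻ z in A i, q z ∂ν
        ≤ D + 2 * ∫⁻ z, q z ∂μ + 2 * ∫⁻ z, q z ∂ν := by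
  set α : ι → Measure Z := fun i => a i • μ.restrict (A i) with hα
  set β : ι → Measure Z := fun i => b i • ν.restrict (A i) with hβ
  have hαle : ∑ i ∈ s, α i ≤ μ := sum_smul_restrict_le s hA hd μ ha
  have hβle : ∑ i ∈ s, β i ≤ ν := sum_smul_restrict_le s hA hd ν hb
  have hfα : ∀ i, IsFiniteMeasure (α i) := fun i =>
    ⟨by
      have := ENNReal.mul_lt_top ((ha i).trans_lt ENNReal.one_lt_top) (measure_lt_top μ (A i))
      simpa [hα] using this⟩
  have hfβ : ∀ i, IsFiniteMeasure (β i) := fun i =>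
    ⟨by
      have := ENNReal.mul_lt_top ((hb i).trans_lt ENNReal.one_lt_top) (measure_lt_top ν (A i))
      simpa [hβ] using this⟩
  have hmass : ∀ i, α i Set.univ = β i Set.univ := fun i => by simpa [hα, hβ] using hab i
  have : IsFiniteMeasure (∑ i ∈ s, α i) := isFiniteMeasure_of_le μ hαle
  have : IsFiniteMeasure (∑ i ∈ s, β i) := isFiniteMeasure_of_le ν hβle
  set α₀ := μ - ∑ i ∈ s, α i
  set β₀ := ν - ∑ i ∈ s, β i
  have hμ : α₀ + ∑ i ∈ s, α i = μ := Measure.sub_add_cancel_of_le hαle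
  have hν : β₀ + ∑ i ∈ s, β i = ν := Measure.sub_add_cancel_of_le hβle
  have : IsFiniteMeasure α₀ := isFiniteMeasure_of_le μ Measure.sub_le
  have : IsFiniteMeasure β₀ := isFiniteMeasure_of_le ν Measure.sub_le
  have hmass₀ : α₀ Set.univ = β₀ Set.univ := by
    have h1 : (α₀ + ∑ i ∈ s, α i) Set.univ = 1 := by rw [hμ]; exact measure_univ
    have h2 : (β₀ + ∑ i ∈ s, β i) Set.univ = 1 := by rw [hν]; exact measure_univ
    rw [Measure.add_apply, Measure.finsetSum_apply] at h1 h2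
    rw [Finset.sum_congr rfl fun i _ => hmass i] at h1
    have h3 : ∑ i ∈ s, β i Set.univ ≠ ∞ :=
      ne_top_of_le_ne_top ENNReal.one_ne_top (h1 ▸ le_add_self)
    exact (ENNReal.add_left_inj h3).1 (h1.trans h2.symm)
  set π := productCoupling α₀ β₀ + ∑ i ∈ s, productCoupling (α i) (β i) with hπ
  have hmap : ∀ (f : Z × Z → Z), Measurable f → π.map f = (productCoupling α₀ β₀).map f
      + ∑ i ∈ s, (productCoupling (α i) (β i)).map f := by
    intro f hf
    ext B hB
    simp only [hπ, Measure.add_apply, Measure.finsetSum_apply, Measure.map_apply hf hB]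
  have hq0 : ∫⁻ p, c p ∂(productCoupling α₀ β₀) ≤ 2 * ∫⁻ z, q z ∂α₀ + 2 * ∫⁻ z, q z ∂β₀ := by
    calc ∫⁻ p, c p ∂(productCoupling α₀ β₀)
        ≤ ∫⁻ p, 2 * (q p.1 + q p.2) ∂(productCoupling α₀ β₀) := lintegral_mono hcq
      _ = 2 * (∫⁻ p, q p.1 ∂(productCoupling α₀ β₀) + ∫⁻ p, q p.2 ∂(productCoupling α₀ β₀)) := by
          rw [lintegral_const_mul _ (by fun_prop), lintegral_add_left (by fun_prop)]
      _ = _ := by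
          rw [← lintegral_map hq measurable_fst, ← lintegral_map hq measurable_snd,
            map_fst_productCoupling _ _ hmass₀, map_snd_productCoupling _ _ hmass₀, mul_add]
  have hqi : ∀ i, ∫⁻ p, c p ∂(productCoupling (α i) (β i)) ≤ D * α i Set.univ := by
    intro i
    have h1 : ∀ᵐ p ∂(productCoupling (α i) (β i)), p.1 ∈ A i := by
      refine ae_of_ae_map measurable_fst.aemeasurable ?_
      rw [map_fst_productCoupling _ _ (hmass i)]
      exact Measure.ae_smul_measure (ae_restrict_mem (hA i)) _
    have h2 : ∀ᵐ p ∂(productCoupling (α i) (β i)), p.2 ∈ A i := by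
      refine ae_of_ae_map measurable_snd.aemeasurable ?_
      rw [map_snd_productCoupling _ _ (hmass i)]
      exact Measure.ae_smul_measure (ae_restrict_mem (hA i)) _
    calc ∫⁻ p, c p ∂(productCoupling (α i) (β i))
        ≤ ∫⁻ _, D ∂(productCoupling (α i) (β i)) := by
          refine lintegral_mono_ae ?_
          filter_upwards [h1, h2] with p hp1 hp2 using hcD i p hp1 hp2
      _ = D * α i Set.univ := by
          rw [lintegral_const]
          congr 1
          conv_rhs => rw [← map_fst_productCoupling _ _ (hmass i),
            Measure.map_apply measurable_fst MeasurableSet.univ, Set.preimage_univ]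
  -- The matched part costs at most `D`, since its total mass is at most one. The unmatched part is
  -- paid for by its own `q`-moments. The conclusion moves the matched moments to the left-hand side
  -- to avoid subtraction in `ℝ≥0∞`.
  have hcπ : ∫⁻ p, c p ∂π ≤ (2 * ∫⁻ z, q z ∂α₀ + 2 * ∫⁻ z, q z ∂β₀) + D := by
    rw [hπ, lintegral_add_measure, lintegral_finsetSum_measure]
    refine add_le_add hq0 ((Finset.sum_le_sum fun i _ => hqi i).trans ?_)
    rw [← Finset.mul_sum, ← Measure.finsetSum_apply]
    exact mul_le_of_le_one_right' ((hαle _).trans_eq measure_univ)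
  refine ⟨π, ?_, ?_, ?_⟩
  · rw [hmap _ measurable_fst, map_fst_productCoupling _ _ hmass₀]
    simp_rw [map_fst_productCoupling _ _ (hmass _)]
    exact hμ
  · rw [hmap _ measurable_snd, map_snd_productCoupling _ _ hmass₀]
    simp_rw [map_snd_productCoupling _ _ (hmass _)]
    exact hν
  · have e1 : ∫⁻ z, q z ∂μ = ∫⁻ z, q z ∂α₀ + ∑ i ∈ s, a i * ∫⁻ z in A i, q z ∂μ := by
      conv_lhs => rw [← hμ]
      rw [lintegral_add_measure, lintegral_finsetSum_measure]
      simp [hα, lintegral_smul_measure]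
    have e2 : ∫⁻ z, q z ∂ν = ∫⁻ z, q z ∂β₀ + ∑ i ∈ s, b i * ∫⁻ z in A i, q z ∂ν := by
      conv_lhs => rw [← hν]
      rw [lintegral_add_measure, lintegral_finsetSum_measure]
      simp [hβ, lintegral_smul_measure]
    rw [e1, e2]
    refine (add_le_add_left (add_le_add_left hcπ _) _).trans_eq ?_
    ring

end Coupling

/-! ### The Borel σ-algebra of the Wasserstein distance. -/

namespace LabelledMeasure

variable {I : Set ℝ} {lam : Measure I} {d : ℕ}

instance (μ : LabelledMeasure lam d) : IsProbabilityMeasure μ.toMeasure := μ.isProbabilityMeasure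

lemma W2_lt_iff {μ ν : LabelledMeasure lam d} {r : ℝ≥0∞} :
    W2 μ ν < r ↔ ∃ π ∈ couplings μ ν,
      ∫⁻ p, (edist p.1.1 p.2.1 ^ 2 + edist p.1.2 p.2.2 ^ 2) ∂π < r ^ 2 := by
  have h : ∀ x : ℝ≥0∞, x ^ (1 / 2 : ℝ) < r ↔ x < r ^ 2 := by
    intro x
    rw [one_div, ENNReal.rpow_inv_lt_iff (by norm_num)]
    norm_num
  rw [W2, h]
  simp only [iInf_lt_iff, exists_prop]

/-- Integrate the Lipschitz bound against a coupling of cost below `r ^ 2`. The elementary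
inequality `x ≤ r + x ^ 2 / r` replaces Cauchy–Schwarz, at the price of the factor 2. -/
lemma edist_integral_le {μ ν : LabelledMeasure lam d} {r : NNReal} (hr : 0 < r) (h : W2 μ ν < r)
    {f : C(I × EuclideanSpace ℝ (Fin d), ℝ)} {K : NNReal} (hf : LipschitzWith K f)
    {C : ℝ} (hC : ∀ z, ‖f z‖ ≤ C) :
    edist (∫ z, f z ∂μ.toMeasure) (∫ z, f z ∂ν.toMeasure) ≤ K * (2 * r) := by
  obtain ⟨π, ⟨hπ1, hπ2⟩, hπ⟩ := W2_lt_iff.1 h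
  have hr0 : (r : ℝ≥0∞) ≠ 0 := by simpa using hr.ne'
  have hprob : IsProbabilityMeasure π := by
    refine ⟨?_⟩
    rw [← Set.preimage_univ (f := Prod.fst), ← Measure.map_apply measurable_fst MeasurableSet.univ,
      hπ1]
    exact measure_univ
  have h1 : ∫ z, f z ∂μ.toMeasure = ∫ p, f p.1 ∂π := by
    rw [← hπ1, integral_map measurable_fst.aemeasurable f.continuous.aestronglyMeasurable]
  have h2 : ∫ z, f z ∂ν.toMeasure = ∫ p, f p.2 ∂π := by
    rw [← hπ2, integral_map measurable_snd.aemeasurable f.continuous.aestronglyMeasurable]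
  have i1 : Integrable (fun p => f p.1) π := Integrable.of_bound
    (f.continuous.comp continuous_fst).aestronglyMeasurable C (Filter.Eventually.of_forall
      fun p => hC p.1)
  have i2 : Integrable (fun p => f p.2) π := Integrable.of_bound
    (f.continuous.comp continuous_snd).aestronglyMeasurable C (Filter.Eventually.of_forall
      fun p => hC p.2)
  have hx : ∀ x : ℝ≥0∞, x ≤ r + x ^ 2 / r := by
    intro x
    rcases le_total x r with hx | hx
    · exact hx.trans le_self_add
    · refine le_trans ?_ le_add_self
      rw [ENNReal.le_div_iff_mul_le (Or.inl hr0) (Or.inl ENNReal.coe_ne_top), sq]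
      gcongr
  rw [h1, h2, edist_eq_enorm_sub, ← integral_sub i1 i2]
  calc ‖∫ p, (f p.1 - f p.2) ∂π‖ₑ ≤ ∫⁻ p, ‖f p.1 - f p.2‖ₑ ∂π := enorm_integral_le_lintegral_enorm _
    _ ≤ ∫⁻ p, K * (r + (edist p.1.1 p.2.1 ^ 2 + edist p.1.2 p.2.2 ^ 2) / r) ∂π := by
        refine lintegral_mono fun p => ?_
        rw [← edist_eq_enorm_sub]
        refine (hf p.1 p.2).trans ?_
        gcongr
        refine (hx _).trans ?_
        gcongr
        rw [Prod.edist_eq]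
        rcases max_choice (edist p.1.1 p.2.1) (edist p.1.2 p.2.2) with h | h <;> rw [h]
        · exact le_self_add
        · exact le_add_self
    _ = K * (r + (∫⁻ p, (edist p.1.1 p.2.1 ^ 2 + edist p.1.2 p.2.2 ^ 2) ∂π) / r) := by
        simp_rw [div_eq_mul_inv]
        rw [lintegral_const_mul _ (by fun_prop), lintegral_add_left (by fun_prop), lintegral_const,
          measure_univ, mul_one, lintegral_mul_const _ (by fun_prop)]
    _ ≤ K * (r + (r : ℝ≥0∞) ^ 2 / r) := by gcongr
    _ = K * (2 * r) := by
        rw [sq, ENNReal.mul_div_cancel_right hr0 ENNReal.coe_ne_top, two_mul]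

/-- Integration against a bounded Lipschitz function is continuous for the Wasserstein distance. -/
lemma continuous_integral {f : C(I × EuclideanSpace ℝ (Fin d), ℝ)} {K : NNReal}
    (hf : LipschitzWith K f) {C : ℝ} (hC : ∀ z, ‖f z‖ ≤ C) :
    Continuous fun μ : LabelledMeasure lam d => ∫ z, f z ∂μ.toMeasure := by
  refine continuous_def.2 fun O hO μ hμ => ?_
  obtain ⟨ε, hε, hball⟩ := Metric.isOpen_iff.1 hO _ hμ
  have hr : 0 < (ε / (2 * (K + 1) + 1)).toNNReal := Real.toNNReal_pos.2 (by positivity)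
  refine ⟨(ε / (2 * (K + 1) + 1)).toNNReal, by exact_mod_cast hr, fun ν hν => hball ?_⟩
  have h := edist_integral_le hr hν hf hC
  rw [Metric.mem_ball, dist_comm, ← edist_lt_ofReal]
  refine h.trans_lt ?_
  have e : (K : ℝ≥0∞) * (2 * ((ε / (2 * (K + 1) + 1)).toNNReal : ℝ≥0∞))
      = ENNReal.ofReal (K * (2 * (ε / (2 * (K + 1) + 1)))) := by
    rw [ENNReal.ofReal_mul (by positivity), ENNReal.ofReal_mul (by norm_num)]
    simp [ENNReal.ofReal]
  rw [e, ENNReal.ofReal_lt_ofReal_iff hε]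
  have hK : (0 : ℝ) ≤ K := K.2
  have h3 : (K : ℝ) * (2 * (ε / (2 * (K + 1) + 1))) = ε * ((2 * K) / (2 * (K + 1) + 1)) := by ring
  rw [h3]
  exact mul_lt_of_lt_one_right hε ((div_lt_one (by positivity)).2 (by linarith))

/-- A σ-algebra for which integrals of bounded Lipschitz functions are measurable makes the
inclusion into the space of measures measurable. -/
lemma measurable_toMeasure_of_integral {m : MeasurableSpace (LabelledMeasure lam d)}
    (h : ∀ f : C(I × EuclideanSpace ℝ (Fin d), ℝ), (∃ K, LipschitzWith K f) → (∀ z, ‖f z‖ ≤ 1) →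
      Measurable fun μ : LabelledMeasure lam d => ∫ z, f z ∂μ.toMeasure) :
    Measurable (toMeasure : LabelledMeasure lam d → _) := by
  refine Measurable.measure_of_isPiSystem_of_isProbabilityMeasure
    (BorelSpace.measurable_eq.trans borel_eq_generateFrom_isClosed) isPiSystem_isClosed
    fun F hF => ?_
  have hδ : ∀ n : ℕ, (0 : ℝ) < 1 / (n + 1) := fun n => by positivity
  have hreal : Measurable fun μ : LabelledMeasure lam d => μ.toMeasure.real F := by
    -- Thickened indicators are bounded Lipschitz functions whose integrals converge to the mass of
    -- the closed set `F`. Closed sets form a generating π-system.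
    refine measurable_of_tendsto_metrizable (f := fun (n : ℕ) μ =>
      ∫ z, (thickenedIndicator (hδ n) F z : ℝ) ∂μ.toMeasure) (fun n => ?_)
      (tendsto_pi_nhds.2 fun μ => tendsto_integral_thickenedIndicator_of_isClosed μ.toMeasure hF hδ
        tendsto_one_div_add_atTop_nhds_zero_nat)
    refine h ⟨fun z => (thickenedIndicator (hδ n) F z : ℝ), by fun_prop⟩
      ⟨_, lipschitzWith_thickenedIndicator (hδ n) F⟩ fun z => ?_
    simpa using thickenedIndicator_le_one (hδ n) F z
  simpa [Measure.real] using hreal.ennreal_ofReal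

lemma measurable_toMeasure : Measurable (toMeasure : LabelledMeasure lam d → _) :=
  measurable_toMeasure_of_integral fun _ ⟨_, hK⟩ hC => (continuous_integral hK hC).measurable

/-- The squared Euclidean norm on `I × ℝ^d`. -/
noncomputable def sqNorm (z : I × EuclideanSpace ℝ (Fin d)) : ℝ≥0∞ := ‖(z.1 : ℝ)‖ₑ ^ 2 + ‖z.2‖ₑ ^ 2

lemma measurable_sqNorm : Measurable (sqNorm (I := I) (d := d)) := by
  unfold sqNorm
  fun_prop

lemma enn_add_sq_le (x y : ℝ≥0∞) : (x + y) ^ 2 ≤ 2 * (x ^ 2 + y ^ 2) := by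
  have := ENNReal.rpow_add_le_mul_rpow_add_rpow x y (p := 2) one_le_two
  norm_num at this
  exact this

lemma sq_edist_le (p : (I × EuclideanSpace ℝ (Fin d)) × (I × EuclideanSpace ℝ (Fin d))) :
    edist p.1.1 p.2.1 ^ 2 + edist p.1.2 p.2.2 ^ 2 ≤ 2 * (sqNorm p.1 + sqNorm p.2) := by
  have h1 : edist p.1.1 p.2.1 ^ 2 ≤ 2 * (‖(p.1.1 : ℝ)‖ₑ ^ 2 + ‖(p.2.1 : ℝ)‖ₑ ^ 2) := by
    refine le_trans ?_ (enn_add_sq_le _ _)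
    gcongr
    rw [Subtype.edist_eq, edist_eq_enorm_sub]
    exact enorm_sub_le
  have h2 : edist p.1.2 p.2.2 ^ 2 ≤ 2 * (‖p.1.2‖ₑ ^ 2 + ‖p.2.2‖ₑ ^ 2) := by
    refine le_trans ?_ (enn_add_sq_le _ _)
    gcongr
    rw [edist_eq_enorm_sub]
    exact enorm_sub_le
  refine (add_le_add h1 h2).trans_eq ?_
  simp only [sqNorm]
  ring

/-- The masses and second moments of the pieces of a countable family of sets, and the total second
moment. -/
noncomputable def momentFeatures {ι : Type*} (A : ι → Set (I × EuclideanSpace ℝ (Fin d)))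
    (μ : LabelledMeasure lam d) : (ι → ℝ) × (ι → ℝ) × ℝ :=
  (fun i => (μ.toMeasure (A i)).toReal, fun i => (∫⁻ z in A i, sqNorm z ∂μ.toMeasure).toReal,
    (∫⁻ z, sqNorm z ∂μ.toMeasure).toReal)

/-- The moment features along partitions of mesh `δ` control the Wasserstein distance. -/
lemma eventually_W2_lt {ι : Type*} {A : ι → Set (I × EuclideanSpace ℝ (Fin d))} {e : ℕ → ι}
    (hA : ∀ i, MeasurableSet (A (e i))) (hd : Pairwise (Function.onFun Disjoint fun i => A (e i)))
    (hcover : ⋃ i, A (e i) = Set.univ) {δ r : NNReal} (hr : 0 < r) (hδ : 4 * δ ^ 2 < r ^ 2)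
    (hdiam : ∀ i, ∀ z ∈ A (e i), ∀ w ∈ A (e i), edist z w ≤ δ) (μ : LabelledMeasure lam d) :
    ∀ᶠ y in nhds (momentFeatures A μ), ∀ ν : LabelledMeasure lam d, momentFeatures A ν = y →
      W2 μ ν < r := by
  have hfin : ∀ ν : LabelledMeasure lam d, ∫⁻ z, sqNorm z ∂ν.toMeasure ≠ ∞ := fun ν =>
    ν.lintegral_sq_lt_top.ne
  have hfini : ∀ (ν : LabelledMeasure lam d) B, ∫⁻ z in B, sqNorm z ∂ν.toMeasure ≠ ∞ := fun ν B =>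
    ne_top_of_le_ne_top (hfin ν) (setLIntegral_le_lintegral B _)
  set m : ℕ → ℝ := fun i => (μ.toMeasure (A (e i))).toReal with hm
  set h : ℕ → ℝ := fun i => (∫⁻ z in A (e i), sqNorm z ∂μ.toMeasure).toReal with hh
  set S : ℝ := (∫⁻ z, sqNorm z ∂μ.toMeasure).toReal with hS
  have hsum : HasSum h S := by
    have h1 : ∫⁻ z, sqNorm z ∂μ.toMeasure = ∑' i, ∫⁻ z in A (e i), sqNorm z ∂μ.toMeasure := by
      rw [← lintegral_iUnion hA hd, hcover, Measure.restrict_univ]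
    have h2 : S = ∑' i, h i := by
      rw [hS, h1, ENNReal.tsum_toReal_eq fun i => hfini μ _]
    rw [h2]
    exact (ENNReal.summable_toReal (by rw [← h1]; exact hfin μ)).hasSum
  have hr2 : (0 : ℝ) < (r : ℝ) ^ 2 := by positivity
  obtain ⟨s₀, hs₀⟩ := (hsum.eventually (lt_mem_nhds (show S - (r : ℝ) ^ 2 / 8 < S by linarith))).exists
  -- Null pieces carry no second moment, so dropping them loses nothing. It keeps the quotients by
  -- `y.1 (e i)` in `bound` continuous at the features of `μ`.
  set s := s₀.filter fun i => m i ≠ 0 with hsdef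
  have hs : S - (r : ℝ) ^ 2 / 8 < ∑ i ∈ s, h i := by
    rw [hsdef, Finset.sum_filter_of_ne]
    · exact hs₀
    · intro i _ hi hmi
      refine hi ?_
      rw [hm, ENNReal.toReal_eq_zero_iff] at hmi
      simp only [hh]
      rw [Measure.restrict_eq_zero.2 (hmi.resolve_right (measure_ne_top _ _)), lintegral_zero_measure,
        ENNReal.toReal_zero]
  have hms : ∀ i ∈ s, m i ≠ 0 := fun i hi => (Finset.mem_filter.1 hi).2
  -- The cost of matching mass `min (m i) (m' i)` inside each piece of `s`, as a function of the
  -- features of `ν`. At `μ` itself it equals `2δ² + 4(S - ∑ h i)`, which is below `r²/2 + r²/2`.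
  let bound : (ι → ℝ) × (ι → ℝ) × ℝ → ℝ := fun y => 2 * (δ : ℝ) ^ 2
    + 2 * (S - ∑ i ∈ s, min (m i) (y.1 (e i)) / m i * h i)
    + 2 * (y.2.2 - ∑ i ∈ s, min (m i) (y.1 (e i)) / y.1 (e i) * y.2.1 (e i))
  have hy1 : ∀ i, (momentFeatures A μ).1 (e i) = m i := fun i => rfl
  have hy2 : ∀ i, (momentFeatures A μ).2.1 (e i) = h i := fun i => rfl
  have hy3 : (momentFeatures A μ).2.2 = S := rfl
  have hcont : ContinuousAt bound (momentFeatures A μ) := by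
    have c1 : ∀ i, ContinuousAt (fun y : (ι → ℝ) × (ι → ℝ) × ℝ => y.1 (e i))
        (momentFeatures A μ) := fun i => by fun_prop
    have c2 : ∀ i, ContinuousAt (fun y : (ι → ℝ) × (ι → ℝ) × ℝ => min (m i) (y.1 (e i)))
        (momentFeatures A μ) := fun i => by fun_prop
    have c3 : ∀ i, ContinuousAt (fun y : (ι → ℝ) × (ι → ℝ) × ℝ => y.2.1 (e i))
        (momentFeatures A μ) := fun i => by fun_prop
    refine (continuousAt_const.add (continuousAt_const.mul (continuousAt_const.sub ?_))).add
      (continuousAt_const.mul (ContinuousAt.sub (by fun_prop) ?_))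
    · exact tendsto_finsetSum _ fun i _ => ((c2 i).div_const _).mul_const _
    · exact tendsto_finsetSum _ fun i hi => ((c2 i).div (c1 i) (hms i hi)).mul (c3 i)
  have hδ' : 4 * (δ : ℝ) ^ 2 < (r : ℝ) ^ 2 := by exact_mod_cast hδ
  have hval : bound (momentFeatures A μ) < (r : ℝ) ^ 2 := by
    have e1 : ∑ i ∈ s, min (m i) (m i) / m i * h i = ∑ i ∈ s, h i :=
      Finset.sum_congr rfl fun i hi => by rw [min_self, div_self (hms i hi), one_mul]
    simp only [bound, hy1, hy2, hy3]
    rw [e1]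
    linarith
  filter_upwards [hcont.eventually (gt_mem_nhds hval)] with y hy ν hν
  set m' : ℕ → ℝ := fun i => (ν.toMeasure (A (e i))).toReal with hm'
  have hm0 : ∀ i, 0 ≤ m i := fun i => ENNReal.toReal_nonneg
  have hm0' : ∀ i, 0 ≤ m' i := fun i => ENNReal.toReal_nonneg
  have hmin : ∀ i, 0 ≤ min (m i) (m' i) := fun i => le_min (hm0 i) (hm0' i)
  obtain ⟨π, hπ1, hπ2, hπ⟩ := exists_coupling_of_partition s hA hd μ.toMeasure ν.toMeasure
    (a := fun i => ENNReal.ofReal (min (m i) (m' i) / m i))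
    (b := fun i => ENNReal.ofReal (min (m i) (m' i) / m' i))
    (fun i => ENNReal.ofReal_le_one.2 (div_le_one_of_le₀ (min_le_left _ _) (hm0 i)))
    (fun i => ENNReal.ofReal_le_one.2 (div_le_one_of_le₀ (min_le_right _ _) (hm0' i)))
    (fun i => by
      rw [← ENNReal.ofReal_toReal (measure_ne_top μ.toMeasure (A (e i))),
        ← ENNReal.ofReal_toReal (measure_ne_top ν.toMeasure (A (e i))),
        ← ENNReal.ofReal_mul (div_nonneg (hmin i) (hm0 i)),
        ← ENNReal.ofReal_mul (div_nonneg (hmin i) (hm0' i))]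
      have e1 : min (m i) (m' i) / m i * m i = min (m i) (m' i) :=
        div_mul_cancel_of_imp fun h => by rw [h, min_eq_left (hm0' i)]
      have e2 : min (m i) (m' i) / m' i * m' i = min (m i) (m' i) :=
        div_mul_cancel_of_imp fun h => by rw [h, min_eq_right (hm0 i)]
      exact congrArg ENNReal.ofReal (e1.trans e2.symm))
    (c := fun p => edist p.1.1 p.2.1 ^ 2 + edist p.1.2 p.2.2 ^ 2) measurable_sqNorm sq_edist_le
    -- The metric on the product is the maximum, so each of the two coordinates contributes at most
    -- `δ ^ 2`.
    (D := 2 * (δ : ℝ≥0∞) ^ 2) (fun i p h1 h2 => by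
      have h3 := hdiam i _ h1 _ h2
      rw [Prod.edist_eq, max_le_iff] at h3
      rw [two_mul]
      gcongr
      exacts [h3.1, h3.2])
  refine W2_lt_iff.2 ⟨π, ⟨hπ1, hπ2⟩, ?_⟩
  set c := ∫⁻ p, (edist p.1.1 p.2.1 ^ 2 + edist p.1.2 p.2.2 ^ 2) ∂π
  have hRtop : 2 * (δ : ℝ≥0∞) ^ 2 + 2 * ∫⁻ z, sqNorm z ∂μ.toMeasure
      + 2 * ∫⁻ z, sqNorm z ∂ν.toMeasure ≠ ∞ := by
    have h1 := hfin μ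
    have h2 := hfin ν
    finiteness
  have hctop : c ≠ ∞ := ne_top_of_le_ne_top hRtop (le_trans (by rw [add_assoc]; exact le_self_add) hπ)
  have hterm : ∀ (κ : LabelledMeasure lam d) (t : ℝ) (i : ℕ),
      ENNReal.ofReal t * ∫⁻ z in A (e i), sqNorm z ∂κ.toMeasure ≠ ∞ := fun κ t i =>
    ENNReal.mul_ne_top ENNReal.ofReal_ne_top (hfini κ _)
  have hreal := ENNReal.toReal_mono hRtop hπ
  have hst : ∀ (κ : LabelledMeasure lam d) (t : ℕ → ℝ),
      2 * ∑ i ∈ s, ENNReal.ofReal (t i) * ∫⁻ z in A (e i), sqNorm z ∂κ.toMeasure ≠ ∞ :=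
    fun κ t => ENNReal.mul_ne_top (by simp) (ENNReal.sum_ne_top.2 fun i _ => hterm κ _ i)
  have hst' : ∀ (κ : LabelledMeasure lam d) (t : ℕ → ℝ), (∀ i, 0 ≤ t i) →
      (2 * ∑ i ∈ s, ENNReal.ofReal (t i) * ∫⁻ z in A (e i), sqNorm z ∂κ.toMeasure).toReal
      = 2 * ∑ i ∈ s, t i * (∫⁻ z in A (e i), sqNorm z ∂κ.toMeasure).toReal := by
    intro κ t ht
    rw [ENNReal.toReal_mul, ENNReal.toReal_sum fun i _ => hterm κ _ i]
    simp [ENNReal.toReal_mul, ENNReal.toReal_ofReal (ht _)]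
  rw [ENNReal.toReal_add (ENNReal.add_ne_top.2 ⟨hctop, hst _ _⟩) (hst _ _),
    ENNReal.toReal_add hctop (hst _ _), hst' _ _ fun i => div_nonneg (hmin i) (hm0 i),
    hst' _ _ fun i => div_nonneg (hmin i) (hm0' i),
    ENNReal.toReal_add (by have h1 := hfin μ; finiteness) (by have h1 := hfin ν; finiteness),
    ENNReal.toReal_add (by finiteness) (by have h1 := hfin μ; finiteness)] at hreal
  simp only [ENNReal.toReal_mul, ENNReal.toReal_pow, ENNReal.toReal_ofNat, ENNReal.coe_toReal]
    at hreal
  have hbound : c.toReal < (r : ℝ) ^ 2 := by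
    refine lt_of_le_of_lt ?_ hy
    rw [← hν]
    simp only [bound, momentFeatures]
    linarith
  rw [← ENNReal.ofReal_toReal hctop, ← ENNReal.ofReal_coe_nnreal,
    ← ENNReal.ofReal_pow r.coe_nonneg]
  exact (ENNReal.ofReal_lt_ofReal_iff hr2).2 hbound

/-- The Borel σ-algebra of the Wasserstein distance is generated by the evaluations
`μ ↦ μ B`. -/
theorem borel_le_comap_toMeasure :
    borel (LabelledMeasure lam d) ≤ MeasurableSpace.comap toMeasure inferInstance := by
  refine MeasurableSpace.generateFrom_le fun U hU => ?_
  have hpart : ∀ n : ℕ, ∃ A : ℕ → Set (I × EuclideanSpace ℝ (Fin d)), (∀ i, MeasurableSet (A i)) ∧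
      (∀ i, ∀ z ∈ A i, ∀ w ∈ A i, edist z w ≤ ((1 / (n + 1) : NNReal) : ℝ≥0∞)) ∧
      ⋃ i, A i = Set.univ ∧ Pairwise fun i j => Disjoint (A i) (A j) := by
    intro n
    obtain ⟨A, h1, h2, h3, h4, h5⟩ := SeparableSpace.exists_measurable_partition_diam_le
      (I × EuclideanSpace ℝ (Fin d)) (ε := 1 / ((n : ℝ) + 1)) (by positivity)
    refine ⟨A, h1, fun i z hz w hw => ?_, h4, h5⟩
    rw [edist_nndist]
    refine ENNReal.coe_le_coe.2 ?_
    rw [← NNReal.coe_le_coe, coe_nndist]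
    exact ((Metric.dist_le_diam_of_mem (h2 i) hz hw).trans (h3 i)).trans_eq (by simp)
  choose A hA hdiam hcover hd using hpart
  -- The partitions of all meshes form one countable family, so a single measurable map into a
  -- second countable space serves all radii.
  let B : ℕ × ℕ → Set (I × EuclideanSpace ℝ (Fin d)) := fun p => A p.1 p.2
  have hB : ∀ p, MeasurableSet (B p) := fun p => hA _ _
  have hF : Measurable[MeasurableSpace.comap toMeasure inferInstance]
      (momentFeatures (lam := lam) B) := by
    have ht : Measurable[MeasurableSpace.comap toMeasure inferInstance]
        (toMeasure : LabelledMeasure lam d → _) := comap_measurable _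
    refine @Measurable.prodMk _ _ _ _ _ (_) _ _ ?_ (@Measurable.prodMk _ _ _ _ _ (_) _ _ ?_ ?_)
    · exact @measurable_pi_lambda _ _ _ (_) _ _ fun p =>
        ((Measure.measurable_coe (hB p)).comp ht).ennreal_toReal
    · refine @measurable_pi_lambda _ _ _ (_) _ _ fun p => ?_
      simp_rw [← lintegral_indicator (hB p)]
      exact ((Measure.measurable_lintegral (measurable_sqNorm.indicator (hB p))).comp
        ht).ennreal_toReal
    · exact ((Measure.measurable_lintegral measurable_sqNorm).comp ht).ennreal_toReal
  -- Every Wasserstein-open set is the preimage of an open set of features: if `ν` has features near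
  -- those of `μ`, it lies in a small ball around `μ`.
  have hUeq : U = momentFeatures B ⁻¹' (interior {y | ∀ ν : LabelledMeasure lam d,
      momentFeatures B ν = y → ν ∈ U}) := by
    refine Set.Subset.antisymm (fun μ hμ => ?_) fun μ hμ => interior_subset hμ μ rfl
    obtain ⟨r₀, hr₀, hball⟩ := hU μ hμ
    obtain ⟨r, hr, hrr₀⟩ := ENNReal.lt_iff_exists_nnreal_btwn.1 hr₀
    replace hr : 0 < r := by exact_mod_cast hr
    obtain ⟨n, hn⟩ := exists_nat_one_div_lt (K := NNReal) (half_pos hr)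
    rw [Set.mem_preimage, mem_interior_iff_mem_nhds]
    refine Filter.mem_of_superset (eventually_W2_lt (e := fun i => (n, i)) (hA n) (hd n) (hcover n)
      (δ := 1 / (n + 1)) hr ?_ (hdiam n) μ) fun y hy ν hν => hball ν
        ((hy ν hν).trans hrr₀)
    calc 4 * (1 / ((n : NNReal) + 1)) ^ 2 < 4 * (r / 2) ^ 2 := by gcongr
      _ = r ^ 2 := by ring
  rw [hUeq]
  exact hF isOpen_interior.measurableSet

/-- A σ-algebra for which the integrals of bounded continuous functions are measurable contains
the Borel σ-algebra of the Wasserstein distance. -/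
theorem borel_le_of_measurable_integral {m : MeasurableSpace (LabelledMeasure lam d)}
    (h : ∀ f : C(I × EuclideanSpace ℝ (Fin d), ℝ), (∀ z, ‖f z‖ ≤ 1) →
      Measurable fun μ : LabelledMeasure lam d => ∫ z, f z ∂μ.toMeasure) :
    borel (LabelledMeasure lam d) ≤ m :=
  borel_le_comap_toMeasure.trans
    (measurable_toMeasure_of_integral fun f _ hf => h f hf).comap_le

end LabelledMeasure

/-! ### Measurability of networks and of their limits. -/

section Measurability

variable {X κ : Type*} [MeasurableSpace X] {σ : ℝ → ℝ} {f : κ → X → ℝ}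

lemma measurable_of_mem_span {S : Set (X → ℝ)} (hS : ∀ g ∈ S, Measurable g) {h : X → ℝ}
    (hh : h ∈ Submodule.span ℝ S) : Measurable h := by
  induction hh using Submodule.span_induction with
  | mem g hg => exact hS g hg
  | zero => exact measurable_const
  | add g h _ _ hg hh => exact hg.add hh
  | smul c g _ hg => exact hg.const_smul c

lemma measurable_of_mem_netClass (hσ : Continuous σ) (hf : ∀ k, Measurable (f k)) {n : ℕ}
    {h : X → ℝ} (hh : h ∈ netClass σ f n) : Measurable h := by
  induction n generalizing h with
  | zero =>
    refine measurable_of_mem_span ?_ hh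
    rintro g (rfl | ⟨k, rfl⟩)
    exacts [measurable_const, hf k]
  | succ n ih =>
    refine measurable_of_mem_span ?_ hh
    rintro g (rfl | ⟨g, hg, rfl⟩)
    exacts [measurable_const, hσ.measurable.comp (ih hg)]

lemma measurable_of_mem_netClosure (hσ : Continuous σ) (hf : ∀ k, Measurable (f k)) {n : ℕ}
    {h : X → ℝ} (hh : h ∈ netClosure σ f n) : Measurable h := by
  choose g hg hgh using fun n : ℕ => hh.2 (1 / (n + 1)) (by positivity)
  refine measurable_of_tendsto_metrizable (fun n => measurable_of_mem_netClass hσ hf (hg n))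
    (tendsto_pi_nhds.2 fun x => tendsto_iff_dist_tendsto_zero.2 (squeeze_zero
      (fun _ => dist_nonneg) (fun n => ?_) tendsto_one_div_add_atTop_nhds_zero_nat))
  rw [dist_comm, Real.dist_eq]
  exact hgh n x

end Measurability

/-! ### The tensor product of two function algebras. -/

section TensorAlgebra

variable {X Y : Type*}

/-- The algebra of functions on `X × Y` generated by functions of `x` in `A` and of `y` in `B`. -/
def tensorAlgebra (A : Subalgebra ℝ (X → ℝ)) (B : Subalgebra ℝ (Y → ℝ)) :
    Subalgebra ℝ (X × Y → ℝ) :=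
  A.map (AlgHom.pi fun p : X × Y => Pi.evalAlgHom ℝ (fun _ : X => ℝ) p.1) ⊔
    B.map (AlgHom.pi fun p : X × Y => Pi.evalAlgHom ℝ (fun _ : Y => ℝ) p.2)

variable {A : Subalgebra ℝ (X → ℝ)} {B : Subalgebra ℝ (Y → ℝ)}

lemma comp_fst_mem_tensorAlgebra {a : X → ℝ} (ha : a ∈ A) :
    (fun p : X × Y => a p.1) ∈ tensorAlgebra A B :=
  (le_sup_left : _ ≤ tensorAlgebra A B) (Subalgebra.mem_map.2 ⟨a, ha, rfl⟩)

lemma comp_snd_mem_tensorAlgebra {b : Y → ℝ} (hb : b ∈ B) :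
    (fun p : X × Y => b p.2) ∈ tensorAlgebra A B :=
  (le_sup_right : _ ≤ tensorAlgebra A B) (Subalgebra.mem_map.2 ⟨b, hb, rfl⟩)

/-- For commuting subalgebras the supremum is, as a submodule, their product, and a product of
submodules is spanned by elementary products. -/
lemma mem_span_of_mem_tensorAlgebra {h : X × Y → ℝ} (hh : h ∈ tensorAlgebra A B) :
    h ∈ Submodule.span ℝ {g : X × Y → ℝ | ∃ a ∈ A, ∃ b ∈ B, g = fun p => a p.1 * b p.2} := by
  rw [tensorAlgebra, ← Subalgebra.mem_toSubmodule, ← Subalgebra.mul_toSubmodule] at hh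
  induction hh using Submodule.mul_induction_on' with
  | mem_mul_mem m hm n hn =>
    obtain ⟨a, ha, rfl⟩ := hm
    obtain ⟨b, hb, rfl⟩ := hn
    exact Submodule.subset_span ⟨a, ha, b, hb, rfl⟩
  | add x _ y _ hx hy => exact Submodule.add_mem _ hx hy

lemma bounded_of_mem_tensorAlgebra (hA : ∀ a ∈ A, ∃ C : ℝ, ∀ x, |a x| ≤ C)
    (hB : ∀ b ∈ B, ∃ C : ℝ, ∀ y, |b y| ≤ C) {h : X × Y → ℝ} (hh : h ∈ tensorAlgebra A B) :
    ∃ C : ℝ, ∀ p, |h p| ≤ C := by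
  have hs := mem_span_of_mem_tensorAlgebra hh
  clear hh
  induction hs using Submodule.span_induction with
  | mem g hg =>
    obtain ⟨a, ha, b, hb, rfl⟩ := hg
    obtain ⟨C, hC⟩ := hA a ha
    obtain ⟨D, hD⟩ := hB b hb
    refine ⟨C * D, fun p => ?_⟩
    rw [abs_mul]
    exact mul_le_mul (hC _) (hD _) (abs_nonneg _) ((abs_nonneg _).trans (hC p.1))
  | zero => exact ⟨0, by simp⟩
  | add p q _ _ hp hq =>
    obtain ⟨C, hC⟩ := hp
    obtain ⟨D, hD⟩ := hq
    exact ⟨C + D, fun t => (abs_add_le _ _).trans (add_le_add (hC t) (hD t))⟩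
  | smul c p _ hp =>
    obtain ⟨C, hC⟩ := hp
    refine ⟨|c| * C, fun t => ?_⟩
    simp only [Pi.smul_apply, smul_eq_mul, abs_mul]
    gcongr
    exact hC t

lemma measurable_of_mem_tensorAlgebra [MeasurableSpace X] [MeasurableSpace Y]
    (hA : ∀ a ∈ A, Measurable a) (hB : ∀ b ∈ B, Measurable b) {h : X × Y → ℝ}
    (hh : h ∈ tensorAlgebra A B) : Measurable h := by
  refine measurable_of_mem_span ?_ (mem_span_of_mem_tensorAlgebra hh)
  rintro g ⟨a, ha, b, hb, rfl⟩
  exact ((hA a ha).comp measurable_fst).mul ((hB b hb).comp measurable_snd)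

/-- The product σ-algebra is the supremum of two pullbacks. By adjunction each reduces to the
generation hypothesis of one factor, applied to the pushforward of `m'`. -/
lemma le_of_measurable_tensorAlgebra [mX : MeasurableSpace X] [mY : MeasurableSpace Y]
    (hA : ∀ m' : MeasurableSpace X, (∀ a ∈ A, Measurable[m'] a) → mX ≤ m')
    (hB : ∀ m' : MeasurableSpace Y, (∀ b ∈ B, Measurable[m'] b) → mY ≤ m')
    (m' : MeasurableSpace (X × Y)) (hm' : ∀ h ∈ tensorAlgebra A B, Measurable[m'] h) :
    (Prod.instMeasurableSpace : MeasurableSpace (X × Y)) ≤ m' := by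
  refine sup_le ?_ ?_
  · exact MeasurableSpace.comap_le_iff_le_map.2
      (hA _ fun a ha => hm' _ (comp_fst_mem_tensorAlgebra ha))
  · exact MeasurableSpace.comap_le_iff_le_map.2
      (hB _ fun b hb => hm' _ (comp_snd_mem_tensorAlgebra hb))

/-- Vector valued combinations over the tensor algebra are finite sums of elementary tensors. -/
lemma exists_sum_of_mem_span_tensorAlgebra {F : Type*} [AddCommGroup F] [Module ℝ F]
    {g : X × Y → F} (hg : g ∈ Submodule.span ℝ
      {g : X × Y → F | ∃ h ∈ tensorAlgebra A B, ∃ c, g = fun p => h p • c}) :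
    ∃ (n : ℕ) (a : Fin n → A) (b : Fin n → B) (c : Fin n → F),
      ∀ p, g p = ∑ k, ((a k : X → ℝ) p.1 * (b k : Y → ℝ) p.2) • c k := by
  have hg' : g ∈ Submodule.span ℝ {g : X × Y → F | ∃ a ∈ A, ∃ b ∈ B, ∃ c,
      g = fun p => (a p.1 * b p.2) • c} := by
    refine (Submodule.span_le.2 ?_ : _ ≤ Submodule.span ℝ _) hg
    rintro _ ⟨h, hh, c, rfl⟩
    have hs := mem_span_of_mem_tensorAlgebra hh
    clear hh
    rw [SetLike.mem_coe]
    induction hs using Submodule.span_induction with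
    | mem g hg =>
      obtain ⟨a, ha, b, hb, rfl⟩ := hg
      exact Submodule.subset_span ⟨a, ha, b, hb, c, rfl⟩
    | zero =>
      simp only [Pi.zero_apply, zero_smul]
      exact Submodule.zero_mem _
    | add p q _ _ hp hq =>
      simpa only [Pi.add_apply, add_smul] using! Submodule.add_mem _ hp hq
    | smul r p _ hp =>
      simpa only [Pi.smul_apply, smul_eq_mul, mul_smul] using! Submodule.smul_mem _ r hp
  obtain ⟨n, r, u, rfl⟩ := Submodule.mem_span_set'.1 hg'
  choose a ha b hb c hc using fun k => (u k).2
  refine ⟨n, fun k => ⟨a k, ha k⟩, fun k => ⟨b k, hb k⟩, fun k => r k • c k, fun p => ?_⟩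
  simp only [Finset.sum_apply, Pi.smul_apply]
  refine Finset.sum_congr rfl fun k _ => ?_
  rw [hc k, smul_comm]

end TensorAlgebra

/-! ### The features: coordinates of a point, integrals against a measure. -/

section Features

variable {I : Set ℝ} {d : ℕ}

/-- The coordinates of a point of `I × ℝ^d`. -/
def coordinate (i : Fin (d + 1)) (z : I × EuclideanSpace ℝ (Fin d)) : ℝ :=
  (Fin.cons (z.1 : ℝ) (fun j => z.2 j) : Fin (d + 1) → ℝ) i

lemma measurable_coordinate (i : Fin (d + 1)) : Measurable (coordinate (I := I) i) := by
  cases i using Fin.cases with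
  | zero => exact measurable_fst.subtype_val
  | succ j =>
    change Measurable fun z : I × EuclideanSpace ℝ (Fin d) => z.2 j
    fun_prop

lemma le_of_measurable_coordinate {m : MeasurableSpace (I × EuclideanSpace ℝ (Fin d))}
    (hm : ∀ i, Measurable[m] (coordinate (I := I) (d := d) i)) :
    (Prod.instMeasurableSpace : MeasurableSpace (I × EuclideanSpace ℝ (Fin d))) ≤ m := by
  have h1 : Measurable[m] (Prod.fst : I × EuclideanSpace ℝ (Fin d) → I) :=
    (hm 0).subtype_mk (h := fun z => z.1.2)
  have h2 : Measurable[m] (Prod.snd : I × EuclideanSpace ℝ (Fin d) → EuclideanSpace ℝ (Fin d)) :=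
    (WithLp.measurable_toLp 2 (Fin d → ℝ)).comp
      (@measurable_pi_lambda _ _ _ m _ _ fun j => hm j.succ)
  exact sup_le h1.comap_le h2.comap_le

/-- The integrals of continuous functions bounded by one. -/
noncomputable def integralFeature {lam : Measure I}
    (f : {f : C(I × EuclideanSpace ℝ (Fin d), ℝ) // ∀ z, ‖f z‖ ≤ 1})
    (μ : LabelledMeasure lam d) : ℝ := ∫ z, f.1 z ∂μ.toMeasure

variable {lam : Measure I}

/-- The inclusion of labelled measures into measures, as a Markov kernel. -/
noncomputable def labelledKernel (lam : Measure I) (d : ℕ) :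
    ProbabilityTheory.Kernel (LabelledMeasure lam d) (I × EuclideanSpace ℝ (Fin d)) :=
  ⟨LabelledMeasure.toMeasure, LabelledMeasure.measurable_toMeasure⟩

instance : ProbabilityTheory.IsMarkovKernel (labelledKernel lam d) :=
  ⟨fun μ => μ.isProbabilityMeasure⟩

lemma measurable_integralFeature
    (f : {f : C(I × EuclideanSpace ℝ (Fin d), ℝ) // ∀ z, ‖f z‖ ≤ 1}) :
    Measurable (integralFeature (lam := lam) f) :=
  (f.1.continuous.stronglyMeasurable.integral_kernel (κ := labelledKernel lam d)).measurable

lemma abs_integralFeature_le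
    (f : {f : C(I × EuclideanSpace ℝ (Fin d), ℝ) // ∀ z, ‖f z‖ ≤ 1}) (μ : LabelledMeasure lam d) :
    |integralFeature f μ| ≤ 1 := by
  have := norm_integral_le_of_norm_le_const (μ := μ.toMeasure) (Filter.Eventually.of_forall f.2)
  simpa [integralFeature] using this

end Features

/-! ### From network limits to the architecture, and the main theorem. -/

/-- Finite sums of elementary tensors of network limits are uniformly approximated by sums of
elementary tensors of networks, with a common depth for the first factors. -/
lemma exists_net_tensor_approx {X Y κ κ' : Type*} {σ : ℝ → ℝ} {f : κ → X → ℝ} {f' : κ' → Y → ℝ}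
    (hσ : Continuous σ) (hna : ¬ ∃ a c : ℝ, ∀ t, σ t = a * t + c)
    {F : Type*} [NormedAddCommGroup F] [NormedSpace ℝ F] {n : ℕ}
    (a : Fin n → netAlgebra f hσ hna) (b : Fin n → netAlgebra f' hσ hna) (c : Fin n → F)
    {η : ℝ} (hη : 0 < η) :
    ∃ (l : ℕ) (a' : Fin n → X → ℝ) (l' : Fin n → ℕ) (b' : Fin n → Y → ℝ),
      (∀ k, a' k ∈ netClass σ f l) ∧ (∀ k, b' k ∈ netClass σ f' (l' k)) ∧
      ∀ x y, ‖∑ k, ((a k : X → ℝ) x * (b k : Y → ℝ) y) • c k - ∑ k, (a' k x * b' k y) • c k‖ ≤ η := by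
  choose la hla using fun k => (a k).2
  choose l' hl' using fun k => (b k).2
  choose Ca hCa using fun k => (hla k).1
  choose Cb hCb using fun k => (hl' k).1
  set M : ℝ := ∑ k, (|Ca k| + |Cb k| + 1) * ‖c k‖ with hM
  have hM0 : 0 ≤ M := Finset.sum_nonneg fun k _ => by positivity
  set θ : ℝ := min 1 (η / (M + 1))
  have hθ : 0 < θ := lt_min one_pos (by positivity)
  -- A common depth lets all the `a' k` later be outputs of one network, hence read the same
  -- features. The second factors go to separate trunk nets and need no common depth.
  have hla' : ∀ k, (a k : X → ℝ) ∈ netClosure σ f (Finset.univ.sup la) := fun k =>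
    netClosure_mono hσ hna (Finset.le_sup (Finset.mem_univ k)) (hla k)
  choose a' ha' haa' using fun k => (hla' k).2 θ hθ
  choose b' hb' hbb' using fun k => (hl' k).2 θ hθ
  refine ⟨_, a', l', b', ha', hb', fun x y => ?_⟩
  rw [← Finset.sum_sub_distrib]
  calc ‖∑ k, (((a k : X → ℝ) x * (b k : Y → ℝ) y) • c k - (a' k x * b' k y) • c k)‖
      ≤ ∑ k, θ * ((|Ca k| + |Cb k| + 1) * ‖c k‖) := by
        refine norm_sum_le_of_le _ fun k _ => ?_
        rw [← sub_smul, norm_smul, ← mul_assoc, Real.norm_eq_abs]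
        refine mul_le_mul_of_nonneg_right ?_ (norm_nonneg _)
        have h1 : |(a k : X → ℝ) x| ≤ |Ca k| := (hCa k x).trans (le_abs_self _)
        have h2 : |(b k : Y → ℝ) y| ≤ |Cb k| := (hCb k y).trans (le_abs_self _)
        have h3 := haa' k x
        have h4 := hbb' k y
        have h5 : |b' k y| ≤ |Cb k| + 1 := by
          have h6 : |b' k y| ≤ |(b k : Y → ℝ) y - b' k y| + |(b k : Y → ℝ) y| := by
            have := abs_sub ((b k : Y → ℝ) y) ((b k : Y → ℝ) y - b' k y)
            rw [sub_sub_cancel] at this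
            linarith
          linarith [min_le_left 1 (η / (M + 1))]
        have e : (a k : X → ℝ) x * (b k : Y → ℝ) y - a' k x * b' k y
            = (a k : X → ℝ) x * ((b k : Y → ℝ) y - b' k y)
              + ((a k : X → ℝ) x - a' k x) * b' k y := by ring
        rw [e]
        calc _ ≤ |(a k : X → ℝ) x| * |(b k : Y → ℝ) y - b' k y|
                + |(a k : X → ℝ) x - a' k x| * |b' k y| := by
              rw [← abs_mul, ← abs_mul]
              exact abs_add_le _ _
          _ ≤ |Ca k| * θ + θ * (|Cb k| + 1) := by gcongr
          _ = _ := by ring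
    _ = θ * M := by rw [hM, Finset.mul_sum]
    _ ≤ η / (M + 1) * (M + 1) := by
        gcongr
        · exact min_le_right _ _
        · linarith
    _ = η := by field_simp

/-- A finite sum of elementary tensors of networks is an instance of the architecture. -/
lemma exists_deepONetCyl_eq {I : Set ℝ} {lam : Measure I} {d q : ℕ} {σ : ℝ → ℝ} {n l : ℕ}
    {a : Fin n → LabelledMeasure lam d → ℝ} (ha : ∀ k, a k ∈ netClass σ integralFeature l)
    {l' : Fin n → ℕ} {b : Fin n → I × EuclideanSpace ℝ (Fin d) → ℝ}
    (hb : ∀ k, b k ∈ netClass σ coordinate (l' k)) (c : Fin n → EuclideanSpace ℝ (Fin q)) :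
    ∃ (J : ℕ) (φ : Fin (J + 1) → C(I × EuclideanSpace ℝ (Fin d), ℝ))
      (T : Fin (n + 1) → FeedforwardNet (d + 1) 1) (B : Fin (n + 1) → FeedforwardNet (J + 1) q),
      (∀ j z, ‖φ j z‖ ≤ 1) ∧ ∀ (z : I × EuclideanSpace ℝ (Fin d)) (μ : LabelledMeasure lam d),
        deepONetCyl σ φ T B (z.1, z.2, μ) = ∑ k, (a k μ * b k z) • c k := by
  obtain ⟨J, s, N, hN⟩ := exists_net_of_mem_netClass l a ha
  choose J' s' N' hN' using fun k => exists_net_of_mem_netClass (l' k)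
    (fun _ : Fin 1 => b k) fun _ => hb k
  -- Prepending a zero feature and a zero summand makes both counts positive. The `k`-th branch net
  -- is the shared network `N` followed by the matrix that sends its outputs to `a k μ • c k`.
  refine ⟨J, Fin.cons 0 fun j => (s j).1, Fin.cons (.output 0 0) fun k => (N' k).selectInputs (s' k),
    Fin.cons (.output 0 0) fun k => (N.postcomp
      (Matrix.of fun i j => if j = k then c k i else 0)).selectInputs Fin.succ, ?_, fun z μ => ?_⟩
  · intro j z
    cases j using Fin.cases with
    | zero => simp
    | succ j => simpa using (s j).2 z
  · rw [deepONetCyl, Fin.sum_univ_succ]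
    simp only [Fin.cons_zero, Fin.cons_succ]
    have h0 : FeedforwardNet.eval σ (.output 0 0 : FeedforwardNet (d + 1) 1)
        (Fin.cons (z.1 : ℝ) fun i => z.2 i) 0 = 0 := by
      simp [FeedforwardNet.eval]
    rw [h0, zero_smul, zero_add]
    refine Finset.sum_congr rfl fun k _ => ?_
    rw [FeedforwardNet.eval_selectInputs, FeedforwardNet.eval_selectInputs,
      FeedforwardNet.eval_postcomp]
    have h1 := congrFun (hN' k z) 0
    have h2 := hN μ
    have h3 : (fun i => cylindricalFeatures (lam := lam) (Fin.cons 0 fun j => (s j).1) μ (Fin.succ i))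
        = fun j => integralFeature (s j) μ := by
      ext j
      simp [cylindricalFeatures, integralFeature]
    have h4 : (fun i => (Fin.cons (z.1 : ℝ) (fun i => z.2 i) : Fin (d + 1) → ℝ) (s' k i))
        = fun j => coordinate (s' k j) z := rfl
    rw [h3, h2, h4, h1]
    ext i
    simp [Matrix.mulVec, dotProduct]
    ring

theorem theorem1 (I : Set ℝ) (hI : IsCompact I) (lam : Measure I) [IsProbabilityMeasure lam]
    (d q : ℕ)
    (σ : ℝ → ℝ) (hσ_cont : Continuous σ)
    (hσ_growth : ∃ L : ℝ, ∀ s t : ℝ, |σ s - σ t| ≤ L * (1 + |s - t|))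
    (hσ_nonpoly : ¬ ∃ P : Polynomial ℝ, ∀ t : ℝ, σ t = P.eval t)
    (ρ : Measure (LabelledMeasure lam d)) [IsProbabilityMeasure ρ]
    (V : I × EuclideanSpace ℝ (Fin d) × LabelledMeasure lam d → EuclideanSpace ℝ (Fin q))
    (hV : Continuous V)
    (hV_sq : ∫⁻ μ, ∫⁻ z, ‖V (z.1, z.2, μ)‖ₑ ^ 2 ∂μ.toMeasure ∂ρ < ∞)
    (ε : ℝ) (hε : 0 < ε) :
    ∃ (J r : ℕ) (φ : Fin J → C(I × EuclideanSpace ℝ (Fin d), ℝ))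
      (T : Fin r → FeedforwardNet (d + 1) 1) (B : Fin r → FeedforwardNet J q),
      0 < J ∧ 0 < r ∧
      (∀ (j : Fin J) (μ : LabelledMeasure lam d), Integrable (φ j) μ.toMeasure) ∧
      ∫⁻ μ, ∫⁻ z, ‖V (z.1, z.2, μ) - deepONetCyl σ φ T B (z.1, z.2, μ)‖ₑ ^ 2
        ∂μ.toMeasure ∂ρ ≤ ENNReal.ofReal ε := by
  have hna : ¬ ∃ a c : ℝ, ∀ t, σ t = a * t + c := fun ⟨a, c, h⟩ =>
    hσ_nonpoly ⟨Polynomial.C a * Polynomial.X + Polynomial.C c, fun t => by simp [h]⟩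
  set P := ρ.compProd (labelledKernel lam d)
  let W : LabelledMeasure lam d × (I × EuclideanSpace ℝ (Fin d)) → EuclideanSpace ℝ (Fin q) :=
    fun p => V (p.2.1, p.2.2, p.1)
  -- A Carathéodory argument, continuous in `z` and measurable in `μ`, gives measurability for the
  -- product σ-algebra without comparing it to the Borel σ-algebra of the product space.
  have hW : Measurable W := by
    have h := measurable_uncurry_of_continuous_of_measurable
      (u := fun (z : I × EuclideanSpace ℝ (Fin d)) (μ : LabelledMeasure lam d) => V (z.1, z.2, μ))
      (fun μ => by fun_prop) fun z => Continuous.measurable (by fun_prop)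
    exact h.comp measurable_swap
  have hWL : MemLp W 2 P := by
    refine ⟨hW.aestronglyMeasurable, ?_⟩
    rw [eLpNorm_lt_top_iff_lintegral_rpow_enorm_lt_top (by simp) (by simp),
      Measure.lintegral_compProd (hW.enorm.pow_const _)]
    simpa [W, labelledKernel] using hV_sq
  obtain ⟨g, hg, hgm, hWg⟩ := exists_mem_span_eLpNorm_sub_le
    (A := tensorAlgebra (netAlgebra (integralFeature (lam := lam) (d := d)) hσ_cont hna)
      (netAlgebra (coordinate (I := I) (d := d)) hσ_cont hna))
    (fun a ha => bounded_of_mem_tensorAlgebra (fun _ h => netAlgebra_bounded h)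
      (fun _ h => netAlgebra_bounded h) ha)
    (fun a ha => measurable_of_mem_tensorAlgebra
      (fun _ h => (mem_netAlgebra.1 h).elim fun _ h =>
        measurable_of_mem_netClosure hσ_cont measurable_integralFeature h)
      (fun _ h => (mem_netAlgebra.1 h).elim fun _ h =>
        measurable_of_mem_netClosure hσ_cont measurable_coordinate h) ha)
    (le_of_measurable_tensorAlgebra
      (fun m hm => LabelledMeasure.borel_le_of_measurable_integral fun f hf =>
        hm (integralFeature ⟨f, hf⟩) (mem_netAlgebra.2 ⟨0, mem_netClosure_of_mem_netClass
          (feature_mem_netClass _) ⟨1, abs_integralFeature_le _⟩⟩))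
      (fun m hm => le_of_measurable_coordinate fun i =>
        measurable_feature_of_netAlgebra hσ_cont hna hσ_growth hσ_nonpoly hm i))
    -- Both the `L²` error and the later uniform error are `√(ε / 4)`. Since `(x + y)² ≤ 2(x² +
    -- y²)`, their squares add up to at most `2 * ε / 4 + 2 * ε / 4 = ε`.
    hWL (ε := ENNReal.ofReal √(ε / 4)) (by simpa using hε)
  obtain ⟨n, a, b, c, hgsum⟩ := exists_sum_of_mem_span_tensorAlgebra hg
  obtain ⟨l, a', l', b', ha', hb', happrox⟩ := exists_net_tensor_approx hσ_cont hna a b c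
    (η := √(ε / 4)) (by positivity)
  obtain ⟨J, φ, T, B, hφ, hD⟩ := exists_deepONetCyl_eq ha' hb' c
  refine ⟨J + 1, n + 1, φ, T, B, J.succ_pos, n.succ_pos, fun j μ => Integrable.of_bound
    (φ j).continuous.aestronglyMeasurable 1 (Filter.Eventually.of_forall (hφ j)), ?_⟩
  have hsq : ENNReal.ofReal √(ε / 4) ^ 2 = ENNReal.ofReal (ε / 4) := by
    rw [← ENNReal.ofReal_pow (Real.sqrt_nonneg _), Real.sq_sqrt (by positivity)]
  have hWg2 : ∫⁻ p, ‖W p - g p‖ₑ ^ 2 ∂P ≤ ENNReal.ofReal (ε / 4) := by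
    rw [eLpNorm_eq_lintegral_rpow_enorm_toReal (by simp) (by simp)] at hWg
    simp only [ENNReal.toReal_ofNat, ENNReal.rpow_ofNat, Pi.sub_apply, one_div] at hWg
    rw [ENNReal.rpow_inv_le_iff (by norm_num), ENNReal.rpow_ofNat, hsq] at hWg
    exact hWg
  have hgm' : Measurable g := hgm.measurable
  calc ∫⁻ μ, ∫⁻ z, ‖V (z.1, z.2, μ) - deepONetCyl σ φ T B (z.1, z.2, μ)‖ₑ ^ 2 ∂μ.toMeasure ∂ρ
      ≤ ∫⁻ μ, ∫⁻ z, (2 * ‖W (μ, z) - g (μ, z)‖ₑ ^ 2 + 2 * ENNReal.ofReal (ε / 4))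
          ∂(labelledKernel lam d μ) ∂ρ := by
        refine lintegral_mono fun μ => lintegral_mono fun z => ?_
        have h1 : ‖g (μ, z) - deepONetCyl σ φ T B (z.1, z.2, μ)‖ₑ ≤ ENNReal.ofReal √(ε / 4) := by
          rw [← ofReal_norm, hgsum, hD]
          exact ENNReal.ofReal_le_ofReal (happrox μ z)
        rw [← hsq, ← mul_add]
        refine le_trans ?_ (LabelledMeasure.enn_add_sq_le _ _)
        refine pow_le_pow_left' ?_ 2
        rw [← sub_add_sub_cancel _ (g (μ, z)) _]
        exact (enorm_add_le _ _).trans (add_le_add le_rfl h1)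
    _ = 2 * ∫⁻ p, ‖W p - g p‖ₑ ^ 2 ∂P + 2 * ENNReal.ofReal (ε / 4) := by
        rw [← Measure.lintegral_compProd
          (f := fun p => 2 * ‖W p - g p‖ₑ ^ 2 + 2 * ENNReal.ofReal (ε / 4)) (by fun_prop),
          lintegral_add_right _ measurable_const, lintegral_const_mul _ (by fun_prop)]
        simp [P]
    _ ≤ 2 * ENNReal.ofReal (ε / 4) + 2 * ENNReal.ofReal (ε / 4) := by gcongr
    _ = ENNReal.ofReal ε := by
        rw [← add_mul, ← ENNReal.ofReal_ofNat 2, ← ENNReal.ofReal_add (by norm_num) (by norm_num),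
          ← ENNReal.ofReal_mul (by norm_num)]
        congr 1
        ring
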